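/- Let $(\Omega,\mathcal A,\mathbb P)$ be a probability space and $T>0$. Let $S=(S_t)_{0\le t\le T}$ be an $\mathbb R^n$-valued process with a.s. continuous paths and $Y=(Y_t)_{0\le t\le T}$ a real-valued process, with generated filtrations $\bar{\mathcal F}^S$, $\bar{\mathcal F}^Y$, and put $\mathcal F_t:=\bar{\mathcal F}^S_t\vee\bar{\mathcal F}^Y_t$. The market of $S$ is arbitrage free and complete: there is exactly one probability measure $\mathbb Q\ll\mathbb P$ on $\bar{\mathcal F}^S_T$ under which $S$ is an $\bar{\mathcal F}^S$-martingale, and its density $d\mathbb Q/d\mathbb P$ is a.s. positive; extend it by $\mathbb Q(A)=\mathbb E[\frac{d\mathbb Q}{d\mathbb P}1_A]$. Let $0\le t_1\le\dots\le t_k\le T$ be fixed times such that a.s. $Y$ has no jumps outside $\{t_1,\dots,t_k\}$ and, with $t_0:=0$, $t_{k+1}:=T$, $\bar{\mathcal F}^Y_{t_{i+1}-}=\bar{\mathcal F}^Y_{t_i}$ (up to null sets) whenever $0\le i\le k$ and $t_i<t_{i+1}$. For $\sigma$-algebras $\mathcal G\subset\mathcal D$, a $\mathcal G$-conditional evaluation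 is a map $\Pi:L^\infty(\mathcal D)\to L^\infty(\mathcal G)$ such that (a.s.) - $\Pi(0)=0$; - $\Pi(H+m)=\Pi(H)+m$ for $m\in L^\infty(\mathcal G)$; - $\Pi(\lambda H_1+(1-\lambda)H_2)\le\lambda\Pi(H_1)+(1-\lambda)\Pi(H_2)$ for $\lambda\in L^\infty(\mathcal G)$ with $0\le\lambda\le1$; - $\Pi(1_AH_1+1_{A^c}H_2)=1_A\Pi(H_1)+1_{A^c}\Pi(H_2)$ for $A\in\mathcal G$; - $\Pi(H)\le\liminf_n\Pi(H_n)$ for every uniformly bounded sequence $H_n\to H$ a.s. It is monotone if $H_1\le H_2$ implies $\Pi(H_1)\le\Pi(H_2)$; positively homogeneous if $\Pi(\lambda H)=\lambda\Pi(H)$ for all $0\le\lambda\in L^\infty(\mathcal G)$; $p$-norm bounded if there are $p\in[1,\infty)$, $0\le\lambda\in L^\infty(\mathcal G)$ and a probability measure $\bar{\mathbb P}$ equivalent to $\mathbb P$ with $\Pi(H)\le\lambda\,\mathbb E_{\bar{\mathbb P}}[|H|^p\mid\mathcal G]$ for all $H$. Let $(\Pi_\sigma)$, indexed by the stopping times $0\le\sigma\le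 T$ of $(\mathcal F_t)$, be a family of $\mathcal F_\sigma$-conditional evaluations $\Pi_\sigma:L^\infty(\mathcal F_T)\to L^\infty(\mathcal F_\sigma)$ which is time-consistent, $\Pi_\sigma(H)=\Pi_\sigma(\Pi_\tau(H))$ for all $\sigma\le\tau$ and $H\in L^\infty(\mathcal F_T)$, and market-consistent, $\Pi_\sigma(H^S+H)=\mathbb E_{\mathbb Q}[H^S\mid\mathcal F_\sigma]+\Pi_\sigma(H)$ for all $\sigma$, $H^S\in L^\infty(\bar{\mathcal F}^S_T\vee\mathcal F_\sigma)$, $H\in L^\infty(\mathcal F_T)$. Assume that all $\Pi_\sigma$ are monotone, or all are $p$-norm bounded, or all are positively homogeneous. Then for every $s\in[0,T]$, with $u:=\min(\{t_i: t_i>s\}\cup\{T\})$ the next update time after $s$ (and $T$ if there is none) and $\mathcal F^S_u:=\bar{\mathcal F}^S_u\vee\mathcal F_s$, there exists an $\mathcal F^S_u$-conditional evaluation $\Pi_{\mathcal F^S_u}:L^\infty(\mathcal F_u)\to L^\infty(\mathcal F^S_u)$ such that $$\Pi_s(H)=\mathbb E_{\mathbb Q}\big[\Pi_{\mathcal F^S_u}(H)\mid\mathcal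 F_s\big]\qquad\text{a.s. for all }H\in L^\infty(\mathcal F_u).$$ -/

import Mathlib

open MeasureTheory Filter Topology
open scoped NNReal ENNReal

namespace MarketConsistent

variable {Ω : Type*} {m0 : MeasurableSpace Ω}

/-- `H` represents an element of `L^∞(Ω, 𝓖, P)`: it is (a.s. equal to) a `𝓖`-measurable function and
it is essentially bounded. -/
def MemLinf (P : Measure Ω) (𝓖 : MeasurableSpace Ω) (H : Ω → ℝ) : Prop :=
  AEStronglyMeasurable[𝓖] H P ∧ ∃ C : ℝ, ∀ᵐ ω ∂P, |H ω| ≤ C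

/-- `Φ` is a `𝓖`-conditional evaluation `L^∞(𝓓) → L^∞(𝓖)`. A map between the two spaces of
equivalence classes is given through representatives, so `Φ` has to respect a.s. equality; its values
outside `L^∞(𝓓)` are irrelevant. -/
structure IsCondEvaluation (P : Measure Ω) (𝓓 𝓖 : MeasurableSpace Ω)
    (Φ : (Ω → ℝ) → Ω → ℝ) : Prop where
  mapsTo : ∀ H, MemLinf P 𝓓 H → MemLinf P 𝓖 (Φ H)
  congr : ∀ H₁ H₂, MemLinf P 𝓓 H₁ → MemLinf P 𝓓 H₂ → H₁ =ᵐ[P] H₂ → Φ H₁ =ᵐ[P] Φ H₂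
  normalized : Φ 0 =ᵐ[P] 0
  cashInvariant : ∀ H m, MemLinf P 𝓓 H → MemLinf P 𝓖 m → Φ (H + m) =ᵐ[P] Φ H + m
  convex : ∀ H₁ H₂ l, MemLinf P 𝓓 H₁ → MemLinf P 𝓓 H₂ → MemLinf P 𝓖 l →
    (∀ᵐ ω ∂P, 0 ≤ l ω ∧ l ω ≤ 1) →
    Φ (l * H₁ + (1 - l) * H₂) ≤ᵐ[P] l * Φ H₁ + (1 - l) * Φ H₂
  localProperty : ∀ H₁ H₂, MemLinf P 𝓓 H₁ → MemLinf P 𝓓 H₂ → ∀ A, MeasurableSet[𝓖] A →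
    Φ (A.indicator H₁ + Aᶜ.indicator H₂) =ᵐ[P] A.indicator (Φ H₁) + Aᶜ.indicator (Φ H₂)
  fatou : ∀ (Hn : ℕ → Ω → ℝ) (H : Ω → ℝ), (∀ n, MemLinf P 𝓓 (Hn n)) → MemLinf P 𝓓 H →
    (∃ C : ℝ, ∀ n, ∀ᵐ ω ∂P, |Hn n ω| ≤ C) →
    (∀ᵐ ω ∂P, Tendsto (fun n => Hn n ω) atTop (𝓝 (H ω))) →
    ∀ᵐ ω ∂P, ((Φ H ω : ℝ) : EReal) ≤ liminf (fun n => ((Φ (Hn n) ω : ℝ) : EReal)) atTop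

/-- Monotonicity on `L^∞(𝓓)`. -/
def IsMonotone (P : Measure Ω) (𝓓 : MeasurableSpace Ω) (Φ : (Ω → ℝ) → Ω → ℝ) : Prop :=
  ∀ H₁ H₂, MemLinf P 𝓓 H₁ → MemLinf P 𝓓 H₂ → H₁ ≤ᵐ[P] H₂ → Φ H₁ ≤ᵐ[P] Φ H₂

/-- `𝓖`-positive homogeneity on `L^∞(𝓓)`. -/
def IsPosHomogeneous (P : Measure Ω) (𝓓 𝓖 : MeasurableSpace Ω) (Φ : (Ω → ℝ) → Ω → ℝ) : Prop :=
  ∀ H l, MemLinf P 𝓓 H → MemLinf P 𝓖 l → 0 ≤ᵐ[P] l → Φ (l * H) =ᵐ[P] l * Φ H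

/-- `p`-norm boundedness: `Φ H ≤ l · ∫ |H|^p dP̄_𝓖` for some `p ∈ [1, ∞)`, some `l ∈ L^∞_+(𝓖)` and
some probability measure `P̄` with the same null sets as `P`. -/
def IsPNormBounded (P : Measure Ω) (𝓓 𝓖 : MeasurableSpace Ω) (Φ : (Ω → ℝ) → Ω → ℝ) : Prop :=
  ∃ (p : ℝ) (l : Ω → ℝ) (Pbar : @Measure Ω m0), 1 ≤ p ∧ MemLinf P 𝓖 l ∧ 0 ≤ᵐ[P] l ∧
    IsProbabilityMeasure Pbar ∧ Pbar ≪ P ∧ P ≪ Pbar ∧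
    ∀ H, MemLinf P 𝓓 H → Φ H ≤ᵐ[P] l * Pbar[fun ω => |H ω| ^ p | 𝓖]

/-- `σ` is a stopping time with values in `[0, T]`. -/
def IsStop (𝓕 : Filtration ℝ≥0 m0) (T : ℝ≥0) (σ : Ω → ℝ≥0) : Prop :=
  IsStoppingTime 𝓕 (fun ω => ((σ ω : ℝ≥0) : WithTop ℝ≥0)) ∧ ∀ ω, σ ω ≤ T

/-- The `σ`-algebra `𝓕_σ` of the events known at the stopping time `σ`. -/
abbrev IsStop.sigma {𝓕 : Filtration ℝ≥0 m0} {T : ℝ≥0} {σ : Ω → ℝ≥0} (hσ : IsStop 𝓕 T σ) :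
    MeasurableSpace Ω :=
  hσ.1.measurableSpace

/-- A continuous-time dynamic (that is, time-consistent) evaluation `(Φ_σ)`, where `σ` runs through
the stopping times with values in `[0, T]`. -/
structure IsDynamicEvaluation (P : Measure Ω) (𝓕 : Filtration ℝ≥0 m0) (T : ℝ≥0)
    (Φ : (Ω → ℝ≥0) → (Ω → ℝ) → Ω → ℝ) : Prop where
  evaluation : ∀ σ (hσ : IsStop 𝓕 T σ), IsCondEvaluation P (𝓕 T) hσ.sigma (Φ σ)
  timeConsistent : ∀ σ τ, IsStop 𝓕 T σ → IsStop 𝓕 T τ → (∀ ω, σ ω ≤ τ ω) →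
    ∀ H, MemLinf P (𝓕 T) H → Φ σ H =ᵐ[P] Φ σ (Φ τ H)

/-- Market-consistency of a dynamic evaluation: here `𝓢` is the `σ`-algebra of the whole stock price
path on `[0, T]` and `Q` is the pricing measure. -/
def IsMarketConsistent (P Q : Measure Ω) (𝓢 : MeasurableSpace Ω) (𝓕 : Filtration ℝ≥0 m0) (T : ℝ≥0)
    (Φ : (Ω → ℝ≥0) → (Ω → ℝ) → Ω → ℝ) : Prop :=
  ∀ σ (hσ : IsStop 𝓕 T σ) (HS H : Ω → ℝ), MemLinf P (𝓢 ⊔ hσ.sigma) HS → MemLinf P (𝓕 T) H →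
    Φ σ (HS + H) =ᵐ[P] Q[HS | hσ.sigma] + Φ σ H

/-- The measure `Q(A) = E[Z 1_A]` with density `Z`, defined on all events. -/
noncomputable def densityMeasure (P : Measure Ω) (Z : Ω → ℝ) : Measure Ω :=
  P.withDensity (fun ω => ENNReal.ofReal (Z ω))

/-- `Z` is the density, measurable with respect to the stock prices up to time `T`, of a probability
measure under which the stock price process `(S_t)_{0 ≤ t ≤ T}` is a martingale in its own
filtration. (The process is frozen after time `T`.) -/
structure IsMartingaleDensity {n : ℕ} (P : Measure Ω) (S : ℝ≥0 → Ω → Fin n → ℝ)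
    (hS : ∀ t, StronglyMeasurable (S t)) (T : ℝ≥0) (Z : Ω → ℝ) : Prop where
  measurable : AEStronglyMeasurable[Filtration.natural S hS T] Z P
  nonneg : 0 ≤ᵐ[P] Z
  isProb : IsProbabilityMeasure (densityMeasure P Z)
  martingale : Martingale (fun t => S (min t T)) (Filtration.natural S hS) (densityMeasure P Z)

/-- The financial market is arbitrage free and complete with pricing density `Z = dQ/dP`: `Q` is an
equivalent martingale measure and it is the only martingale measure on the `σ`-algebra of the
stocks. -/
structure IsCompleteMarketDensity {n : ℕ} (P : Measure Ω) (S : ℝ≥0 → Ω → Fin n → ℝ)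
    (hS : ∀ t, StronglyMeasurable (S t)) (T : ℝ≥0) (Z : Ω → ℝ) : Prop where
  isMartingaleDensity : IsMartingaleDensity P S hS T Z
  pos : ∀ᵐ ω ∂P, 0 < Z ω
  unique : ∀ Z', IsMartingaleDensity P S hS T Z' → Z' =ᵐ[P] Z

/-- The left limit `𝓖_{b-}` of a filtration. -/
abbrev leftSigma (𝓖 : Filtration ℝ≥0 m0) (b : ℝ≥0) : MeasurableSpace Ω := ⨆ r, ⨆ _ : r < b, 𝓖 r

/-- Two `σ`-algebras agree up to `P`-null sets. -/
def SigmaAEEq (P : Measure Ω) (m₁ m₂ : MeasurableSpace Ω) : Prop :=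
  (∀ A, MeasurableSet[m₁] A → ∃ B, MeasurableSet[m₂] B ∧ A =ᵐ[P] B) ∧
    ∀ B, MeasurableSet[m₂] B → ∃ A, MeasurableSet[m₁] A ∧ A =ᵐ[P] B

/-- The update times `t_1, …, t_k` together with `t_0 = 0` and `t_{k+1} = T`. -/
def updateGrid {k : ℕ} (t : Fin k → ℝ≥0) (T : ℝ≥0) : Set ℝ≥0 := insert 0 (insert T (Set.range t))

/-- The insurance process has no jumps on `[0, T]` outside the times `t_1, …, t_k`, and its filtration
gains no information strictly between two successive times of the grid
`0 = t_0 ≤ t_1 ≤ … ≤ t_k ≤ t_{k+1} = T`. -/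
structure UpdatesOnlyAt (P : Measure Ω) (Y : ℝ≥0 → Ω → ℝ) (hY : ∀ t, StronglyMeasurable (Y t))
    (T : ℝ≥0) {k : ℕ} (t : Fin k → ℝ≥0) : Prop where
  noOtherJumps : ∀ᵐ ω ∂P, ∀ r ∈ Set.Icc 0 T, r ∉ Set.range t →
    ContinuousWithinAt (fun u => Y u ω) (Set.Icc 0 T) r
  noInformation : ∀ a ∈ updateGrid t T, ∀ b ∈ updateGrid t T, a < b →
    (∀ c ∈ updateGrid t T, ¬ (a < c ∧ c < b)) →
    SigmaAEEq P (leftSigma (Filtration.natural Y hY) b) (Filtration.natural Y hY a)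

/-- The next update time after `s`, that is `inf {t_i | t_i > s} ∧ T`. -/
noncomputable def nextUpdate {k : ℕ} (t : Fin k → ℝ≥0) (T s : ℝ≥0) : ℝ≥0 :=
  sInf (insert T {u | u ∈ Set.range t ∧ s < u})

end MarketConsistent

namespace MarketConsistent

variable {Ω : Type*} {m m₁ m₂ 𝓓 𝓖 𝓐 : MeasurableSpace Ω} {m0 : MeasurableSpace Ω}

/-! Write 𝓐 for `𝓕 s`, 𝓖 for the σ-algebra generated by the stocks up to the next update time `u`
together with `𝓕 s`, and choose `r n` strictly increasing to `u` with `s < r n < u`. Before `u` only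
the stocks bring news, so `𝓕 (r n)` lies in 𝓖 up to null sets. Hence `Φ_{r n} H` is a hedgeable
payoff, and time-consistency followed by market-consistency gives `Φ_s H = E_Q[Φ_{r n} H | 𝓕 s]`.
Conversely, by path continuity the `𝓕 (r n)` generate 𝓖 up to null sets. The structure `IsRefinedBy`
records this situation.

The required evaluation is a Radon-Nikodym density: `Θ H` is the `Q`-density on 𝓖 of `A ↦
E_Q[Φ_s(1_A H)]`. For events of `𝓕 (r n)` additivity follows from the local property of `Φ_{r n}`.
It extends to 𝓖 by approximating events and using the Fatou property twice, once for each inequality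
(`add_of_measurable`). Countable additivity then needs only convergence (`tendsto_indicator_apply`)
and a uniform bound obtained by gluing (`IsCondEvaluation.exists_bound`).

By construction `E_Q[Θ H | 𝓕 (r n)] = Φ_{r n} H`, so `Θ H` is the almost sure limit of this
martingale. It is bounded: otherwise the martingale would be arbitrarily large on disjoint non-null
events, each known at its own time, and stopping there would give a stopping time `σ` with `Φ_σ H`
unbounded (`exists_disjoint_large`, `IsDynamicEvaluation.exists_bound`). The other axioms for `Θ`
are checked by integrating over events of 𝓖. The Fatou property comes from gluing a sequence along
the places where it violates the inequality (`density_fatou`), and convexity with random weights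
then follows from constant weights (`density_convex`). -/

/-- Every event of `m₁` is, up to a `P`-null set, an event of `m₂`. -/
def SigmaAELe (P : Measure Ω) (m₁ m₂ : MeasurableSpace Ω) : Prop :=
  ∀ A, MeasurableSet[m₁] A → ∃ B, MeasurableSet[m₂] B ∧ A =ᵐ[P] B

/-! ### Bounded functions measurable up to null sets -/

section MemLinf

variable {P : Measure Ω} {f g H H₁ H₂ : Ω → ℝ}

theorem aestronglyMeasurable_of_tendsto_sub {f : ℕ → Ω → ℝ}
    (hf : ∀ n, AEStronglyMeasurable[m] (f n) P)
    (h : ∀ᵐ ω ∂P, Tendsto (fun n => f n ω) atTop (𝓝 (g ω))) : AEStronglyMeasurable[m] g P := by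
  choose f' hf' hff' using hf
  -- The real `limsup` is measurable whatever its value at points of divergence; only points of
  -- convergence matter.
  refine ⟨fun ω => limsup (fun n => f' n ω) atTop, ?_, ?_⟩
  · exact (Measurable.limsup fun n => (hf' n).measurable).stronglyMeasurable
  · filter_upwards [h, ae_all_iff.2 hff'] with ω h1 h2
    simp only [← h2]
    exact h1.limsup_eq.symm

theorem aestronglyMeasurable_add_sub (hf : AEStronglyMeasurable[m] f P)
    (hg : AEStronglyMeasurable[m] g P) : AEStronglyMeasurable[m] (f + g) P := by
  obtain ⟨f', hf', h1⟩ := hf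
  obtain ⟨g', hg', h2⟩ := hg
  exact ⟨f' + g', hf'.add hg', h1.add h2⟩

/-- Inclusion of events up to null sets passes to indicators directly, then to sums and pointwise
limits. -/
theorem SigmaAELe.aestronglyMeasurable (h : SigmaAELe P m₁ m₂)
    (hf : AEStronglyMeasurable[m₁] f P) : AEStronglyMeasurable[m₂] f P := by
  obtain ⟨g, hg, hfg⟩ := hf
  suffices AEStronglyMeasurable[m₂] g P by
    obtain ⟨k, hk, hgk⟩ := this
    exact ⟨k, hk, hfg.trans hgk⟩
  clear hfg
  induction g, hg using StronglyMeasurable.induction with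
  | @ind c A hs =>
    obtain ⟨B, hB, hAB⟩ := h _ hs
    refine ⟨B.indicator fun _ => c, stronglyMeasurable_const.indicator hB, ?_⟩
    filter_upwards [hAB] with ω hω
    have hω' : (ω ∈ A) = (ω ∈ B) := hω
    by_cases hA' : ω ∈ A
    · rw [Set.indicator_of_mem hA', Set.indicator_of_mem (hω' ▸ hA')]
    · rw [Set.indicator_of_notMem hA', Set.indicator_of_notMem (hω' ▸ hA')]
  | add hf hg hfg hd h1 h2 => exact aestronglyMeasurable_add_sub h1 h2
  | lim hf hg h1 h2 =>
    exact aestronglyMeasurable_of_tendsto_sub h1 (Eventually.of_forall h2)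

theorem SigmaAELe.memLinf (h : SigmaAELe P m₁ m₂) (hH : MemLinf P m₁ H) : MemLinf P m₂ H :=
  ⟨h.aestronglyMeasurable hH.1, hH.2⟩

theorem SigmaAELe.of_le (h : m₁ ≤ m₂) : SigmaAELe P m₁ m₂ :=
  fun A hA => ⟨A, h _ hA, Filter.EventuallyEq.rfl⟩

theorem MemLinf.mono (h : m₁ ≤ m₂) (hH : MemLinf P m₁ H) : MemLinf P m₂ H :=
  ⟨hH.1.mono h, hH.2⟩

theorem MemLinf.const (c : ℝ) : MemLinf P m (fun _ => c) :=
  ⟨⟨_, stronglyMeasurable_const, EventuallyEq.rfl⟩, |c|, Eventually.of_forall fun _ => le_rfl⟩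

theorem MemLinf.zero : MemLinf P m 0 := MemLinf.const 0

theorem MemLinf.add (h₁ : MemLinf P m H₁) (h₂ : MemLinf P m H₂) : MemLinf P m (H₁ + H₂) := by
  obtain ⟨hm₁, C₁, hC₁⟩ := h₁
  obtain ⟨hm₂, C₂, hC₂⟩ := h₂
  refine ⟨aestronglyMeasurable_add_sub hm₁ hm₂, C₁ + C₂, ?_⟩
  filter_upwards [hC₁, hC₂] with ω a b
  exact (abs_add_le _ _).trans (add_le_add a b)

theorem MemLinf.mul (h₁ : MemLinf P m H₁) (h₂ : MemLinf P m H₂) : MemLinf P m (H₁ * H₂) := by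
  obtain ⟨⟨f', hf', h1⟩, C₁, hC₁⟩ := h₁
  obtain ⟨⟨g', hg', h2⟩, C₂, hC₂⟩ := h₂
  refine ⟨⟨f' * g', hf'.mul hg', h1.mul h2⟩, C₁ * C₂, ?_⟩
  filter_upwards [hC₁, hC₂] with ω a b
  rw [Pi.mul_apply, abs_mul]
  exact mul_le_mul a b (abs_nonneg _) ((abs_nonneg _).trans a)

theorem MemLinf.sub (h₁ : MemLinf P m H₁) (h₂ : MemLinf P m H₂) : MemLinf P m (H₁ - H₂) := by
  have : H₁ - H₂ = H₁ + (fun _ => (-1 : ℝ)) * H₂ := by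
    ext ω; simp [sub_eq_add_neg]
  rw [this]
  exact h₁.add ((MemLinf.const _).mul h₂)

theorem MemLinf.indicator (hH : MemLinf P m H) {A : Set Ω} (hA : MeasurableSet[m] A) :
    MemLinf P m (A.indicator H) := by
  obtain ⟨⟨g, hg, hfg⟩, C, hC⟩ := hH
  refine ⟨⟨A.indicator g, hg.indicator hA, ?_⟩, C, ?_⟩
  · filter_upwards [hfg] with ω h
    by_cases hω : ω ∈ A <;> simp [hω, h]
  · filter_upwards [hC] with ω h
    by_cases hω : ω ∈ A
    · simpa [hω] using h
    · simpa [hω] using (abs_nonneg _).trans h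

theorem MemLinf.aestronglyMeasurable (hm : m ≤ m0) (hH : MemLinf P m H) :
    AEStronglyMeasurable H P := hH.1.mono hm

theorem MemLinf.integrable (hm : m ≤ m0) {Q : Measure Ω} [IsFiniteMeasure Q] (hQ : Q ≪ P)
    (hH : MemLinf P m H) : Integrable H Q := by
  obtain ⟨C, hC⟩ := hH.2
  exact Integrable.of_bound ((hH.aestronglyMeasurable hm).mono_ac hQ) C (hQ.ae_le hC)

theorem MemLinf.of_tendsto {F : ℕ → Ω → ℝ} (hF : ∀ n, MemLinf P m (F n)) {C : ℝ}
    (hC : ∀ n, ∀ᵐ ω ∂P, |F n ω| ≤ C)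
    (h : ∀ᵐ ω ∂P, Tendsto (fun n => F n ω) atTop (𝓝 (H ω))) : MemLinf P m H := by
  refine ⟨aestronglyMeasurable_of_tendsto_sub (fun n => (hF n).1) h, C, ?_⟩
  filter_upwards [h, ae_all_iff.2 hC] with ω h1 h2
  exact le_of_tendsto h1.abs (Eventually.of_forall h2)

/-- Bounded functions can be glued along a sequence of pairwise disjoint events. -/
theorem exists_memLinf_glue {D : ℕ → Set Ω} (hD : ∀ n, MeasurableSet[m] (D n))
    (hdisj : Pairwise (Function.onFun Disjoint D)) {F : ℕ → Ω → ℝ} {F₀ : Ω → ℝ}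
    (hF : ∀ n, MemLinf P m (F n)) (hF₀ : MemLinf P m F₀) {C : ℝ}
    (hC : ∀ n, ∀ᵐ ω ∂P, |F n ω| ≤ C) (hC₀ : ∀ᵐ ω ∂P, |F₀ ω| ≤ C) :
    ∃ K : Ω → ℝ, MemLinf P m K ∧ (∀ᵐ ω ∂P, |K ω| ≤ C) ∧ (∀ n, ∀ ω ∈ D n, K ω = F n ω) ∧
      ∀ ω, (∀ n, ω ∉ D n) → K ω = F₀ ω := by
  classical
  have hun : ∀ {ω i j}, ω ∈ D i → ω ∈ D j → i = j := fun {ω i j} hi hj => by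
    by_contra hne
    exact Set.disjoint_left.1 (hdisj hne) hi hj
  -- `K N` glues along the first `N` events only. Each increment is a single pasting over two
  -- events, and `L` is the pointwise limit because the sequence is eventually constant at every
  -- point.
  let K : ℕ → Ω → ℝ := fun N ω => if h : ∃ n, ω ∈ D n ∧ n < N then F h.choose ω else F₀ ω
  let L : Ω → ℝ := fun ω => if h : ∃ n, ω ∈ D n then F h.choose ω else F₀ ω
  have hL1 : ∀ n, ∀ ω ∈ D n, L ω = F n ω := fun n ω hω => by
    have h : ∃ n, ω ∈ D n := ⟨n, hω⟩
    simp only [L, dif_pos h]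
    rw [hun h.choose_spec hω]
  have hL0 : ∀ ω, (∀ n, ω ∉ D n) → L ω = F₀ ω := fun ω hω => by
    have h : ¬ ∃ n, ω ∈ D n := by simpa using hω
    simp only [L, dif_neg h]
  have hK : ∀ N, MemLinf P m (K N) := by
    intro N
    induction N with
    | zero => simpa [K] using hF₀
    | succ N ih =>
      have : K (N + 1) = (D N).indicator (F N) + (D N)ᶜ.indicator (K N) := by
        ext ω
        by_cases hω : ω ∈ D N
        · have h : ∃ n, ω ∈ D n ∧ n < N + 1 := ⟨N, hω, N.lt_succ_self⟩
          simp only [K, dif_pos h, Pi.add_apply, Set.indicator_of_mem hω,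
            Set.indicator_of_notMem (Set.notMem_compl_iff.2 hω), add_zero]
          rw [hun h.choose_spec.1 hω]
        · simp only [Pi.add_apply, Set.indicator_of_notMem hω,
            Set.indicator_of_mem (Set.mem_compl hω), zero_add, K]
          by_cases h : ∃ n, ω ∈ D n ∧ n < N
          · have h' : ∃ n, ω ∈ D n ∧ n < N + 1 := h.imp fun n hn => ⟨hn.1, hn.2.trans N.lt_succ_self⟩
            rw [dif_pos h, dif_pos h', hun h.choose_spec.1 h'.choose_spec.1]
          · have h' : ¬ ∃ n, ω ∈ D n ∧ n < N + 1 := by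
              rintro ⟨n, hn, hnN⟩
              rcases Nat.lt_succ_iff_lt_or_eq.1 hnN with h1 | rfl
              · exact h ⟨n, hn, h1⟩
              · exact hω hn
            rw [dif_neg h, dif_neg h']
      rw [this]
      exact ((hF N).indicator (hD N)).add (ih.indicator (hD N).compl)
  have hKC : ∀ N, ∀ᵐ ω ∂P, |K N ω| ≤ C := fun N => by
    filter_upwards [ae_all_iff.2 hC, hC₀] with ω h1 h2
    simp only [K]
    split_ifs
    · exact h1 _
    · exact h2
  have hlim : ∀ ω, Tendsto (fun N => K N ω) atTop (𝓝 (L ω)) := fun ω => by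
    by_cases h : ∃ n, ω ∈ D n
    · obtain ⟨n, hn⟩ := h
      refine tendsto_const_nhds.congr' ?_
      filter_upwards [eventually_gt_atTop n] with N hN
      have h' : ∃ n, ω ∈ D n ∧ n < N := ⟨n, hn, hN⟩
      rw [hL1 n ω hn]
      simp only [K, dif_pos h']
      rw [hun h'.choose_spec.1 hn]
    · refine tendsto_const_nhds.congr fun N => ?_
      have h' : ¬ ∃ n, ω ∈ D n ∧ n < N := fun ⟨n, hn⟩ => h ⟨n, hn.1⟩
      simp only [K, L, dif_neg h, dif_neg h']
  refine ⟨L, MemLinf.of_tendsto hK hKC (Eventually.of_forall hlim), ?_, hL1, hL0⟩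
  filter_upwards [ae_all_iff.2 hC, hC₀] with ω h1 h2
  simp only [L]
  split_ifs
  · exact h1 _
  · exact h2

end MemLinf

/-! ### Elementary properties of conditional evaluations -/

namespace IsCondEvaluation

variable {P : Measure Ω} {Φ : (Ω → ℝ) → Ω → ℝ} {H H₁ H₂ : Ω → ℝ}

theorem mono_left {𝓓' : MeasurableSpace Ω} (h : IsCondEvaluation P 𝓓 𝓖 Φ) (hle : 𝓓' ≤ 𝓓) :
    IsCondEvaluation P 𝓓' 𝓖 Φ where
  mapsTo H hH := h.mapsTo H (hH.mono hle)
  congr H₁ H₂ h₁ h₂ := h.congr H₁ H₂ (h₁.mono hle) (h₂.mono hle)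
  normalized := h.normalized
  cashInvariant H m hH := h.cashInvariant H m (hH.mono hle)
  convex H₁ H₂ l h₁ h₂ := h.convex H₁ H₂ l (h₁.mono hle) (h₂.mono hle)
  localProperty H₁ H₂ h₁ h₂ := h.localProperty H₁ H₂ (h₁.mono hle) (h₂.mono hle)
  fatou Hn H hn hH := h.fatou Hn H (fun n => (hn n).mono hle) (hH.mono hle)

theorem indicator (h : IsCondEvaluation P 𝓓 𝓖 Φ) (hH : MemLinf P 𝓓 H) {A : Set Ω}
    (hA : MeasurableSet[𝓖] A) : Φ (A.indicator H) =ᵐ[P] A.indicator (Φ H) := by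
  have h1 := h.localProperty H 0 hH MemLinf.zero A hA
  simp only [Set.indicator_zero', add_zero] at h1
  filter_upwards [h1, h.normalized] with ω h1 h2
  rw [h1]
  by_cases hω : ω ∈ A <;> simp [hω, h2]

/-- Locality: the payoffs multiplied by the indicator of `A` coincide, and this indicator can be
pulled out of `Φ`. -/
theorem ae_eq_on (h : IsCondEvaluation P 𝓓 𝓖 Φ) (hle : 𝓖 ≤ 𝓓) (h₁ : MemLinf P 𝓓 H₁)
    (h₂ : MemLinf P 𝓓 H₂) {A : Set Ω} (hA : MeasurableSet[𝓖] A)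
    (heq : ∀ᵐ ω ∂P, ω ∈ A → H₁ ω = H₂ ω) : ∀ᵐ ω ∂P, ω ∈ A → Φ H₁ ω = Φ H₂ ω := by
  have h3 : A.indicator H₁ =ᵐ[P] A.indicator H₂ := by
    filter_upwards [heq] with ω hω
    by_cases hA : ω ∈ A
    · simp [hA, hω hA]
    · simp [hA]
  have h4 := h.congr _ _ (h₁.indicator (hle _ hA)) (h₂.indicator (hle _ hA)) h3
  filter_upwards [h4, h.indicator h₁ hA, h.indicator h₂ hA] with ω a b c hω
  rw [a, c] at b
  simpa [hω] using b.symm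

theorem apply_of_memLinf (h : IsCondEvaluation P 𝓓 𝓖 Φ) (hH : MemLinf P 𝓖 H) :
    Φ H =ᵐ[P] H := by
  have h1 := h.cashInvariant 0 H MemLinf.zero hH
  rw [zero_add] at h1
  filter_upwards [h1, h.normalized] with ω a b
  simp [a, b]

theorem eventually_lt (h : IsCondEvaluation P 𝓓 𝓖 Φ) {F : ℕ → Ω → ℝ} (hF : ∀ n, MemLinf P 𝓓 (F n))
    (hH : MemLinf P 𝓓 H) {C : ℝ} (hC : ∀ n, ∀ᵐ ω ∂P, |F n ω| ≤ C)
    (hlim : ∀ᵐ ω ∂P, Tendsto (fun n => F n ω) atTop (𝓝 (H ω))) :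
    ∀ᵐ ω ∂P, ∀ ε > 0, ∀ᶠ n in atTop, Φ H ω - ε < Φ (F n) ω := by
  filter_upwards [h.fatou F H hF hH ⟨C, hC⟩ hlim] with ω hω ε hε
  have h1 : ((Φ H ω - ε : ℝ) : EReal) < liminf (fun n => ((Φ (F n) ω : ℝ) : EReal)) atTop :=
    lt_of_lt_of_le (by exact_mod_cast sub_lt_self _ hε) hω
  filter_upwards [eventually_lt_of_lt_liminf h1] with n hn
  exact_mod_cast hn

end IsCondEvaluation

theorem le_liminf_ereal {a : ℕ → ℝ} {b : ℝ} (h : ∀ j : ℕ, ∀ᶠ n in atTop, b - 1 / (j + 1) ≤ a n) :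
    (b : EReal) ≤ liminf (fun n => (a n : EReal)) atTop := by
  refine le_of_forall_lt fun c hc => ?_
  obtain ⟨x, hcx, hxb⟩ := EReal.lt_iff_exists_real_btwn.1 hc
  have hxb' : x < b := by exact_mod_cast hxb
  obtain ⟨j, hj⟩ := exists_nat_one_div_lt (sub_pos.2 hxb')
  refine hcx.trans_le (le_liminf_of_le (by isBoundedDefault) ?_)
  filter_upwards [h j] with n hn
  have : x ≤ a n := by linarith
  exact_mod_cast this

/-- Two sequences with constant sum and lower limits at least `a` and `b`. -/
theorem add_le_of_eventually_lt {x y : ℕ → ℝ} {a b c : ℝ} (h : ∀ n, x n + y n = c)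
    (hx : ∀ ε > 0, ∀ᶠ n in atTop, a - ε < x n) (hy : ∀ ε > 0, ∀ᶠ n in atTop, b - ε < y n) :
    a + b ≤ c := by
  refine le_of_forall_pos_le_add fun ε hε => ?_
  obtain ⟨n, h1, h2⟩ := ((hx (ε / 2) (by positivity)).and (hy (ε / 2) (by positivity))).exists
  linarith [h n]

/-- A lower bound on `y` is an upper bound on `x` when the sum is fixed. This turns the one-sided
Fatou property into convergence whenever two complementary pieces add up to a constant. -/
theorem tendsto_of_eventually_lt {x y : ℕ → ℝ} {a b : ℝ} (h : ∀ n, x n + y n = a + b)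
    (hx : ∀ ε > 0, ∀ᶠ n in atTop, a - ε < x n) (hy : ∀ ε > 0, ∀ᶠ n in atTop, b - ε < y n) :
    Tendsto x atTop (𝓝 a) := by
  rw [Metric.tendsto_atTop']
  intro ε hε
  obtain ⟨N, hN⟩ := eventually_atTop.1 ((hx ε hε).and (hy ε hε))
  refine ⟨N, fun n hn => ?_⟩
  have := hN n hn.le
  rw [Real.dist_eq, abs_lt]
  constructor <;> linarith [h n]

/-! ### Radon-Nikodym densities of real set functions -/

section Density

/-- A finitely additive set function which is continuous along convergent sequences of events and
vanishes on null sets has an integrable density. -/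
theorem exists_density (Q : Measure Ω) [IsFiniteMeasure Q] (ν : Set Ω → ℝ)
    (hnull : ∀ A, MeasurableSet A → Q A = 0 → ν A = 0)
    (hadd : ∀ A B, MeasurableSet A → MeasurableSet B → Disjoint A B → ν (A ∪ B) = ν A + ν B)
    (hcont : ∀ (A : ℕ → Set Ω) (B : Set Ω), (∀ n, MeasurableSet (A n)) → MeasurableSet B →
      (∀ ω, ∀ᶠ n in atTop, ω ∈ A n ↔ ω ∈ B) → Tendsto (fun n => ν (A n)) atTop (𝓝 (ν B))) :
    ∃ X : Ω → ℝ, StronglyMeasurable X ∧ Integrable X Q ∧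
      ∀ A, MeasurableSet A → ∫ ω in A, X ω ∂Q = ν A := by
  classical
  have hempty : ν ∅ = 0 := hnull ∅ MeasurableSet.empty measure_empty
  have hsum : ∀ (f : ℕ → Set Ω), (∀ i, MeasurableSet (f i)) →
      Pairwise (Function.onFun Disjoint f) → ∀ F : Finset ℕ,
      ν (⋃ i ∈ F, f i) = ∑ i ∈ F, ν (f i) := by
    intro f hf hd F
    induction F using Finset.induction_on with
    | empty => simpa using hempty
    | insert a F ha ih =>
      rw [Finset.set_biUnion_insert, Finset.sum_insert ha, hadd _ _ (hf a)
        (F.measurableSet_biUnion fun i _ => hf i), ih]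
      refine Set.disjoint_iUnion₂_right.2 fun i hi => hd ?_
      rintro rfl
      exact ha hi
  let s : SignedMeasure Ω :=
    { measureOf' := fun A => if MeasurableSet A then ν A else 0
      empty' := by simp [hempty]
      not_measurable' := fun A hA => by simp [hA]
      m_iUnion' := by
        intro f hf hd
        simp only [hf, if_true, MeasurableSet.iUnion hf]
        -- Summability runs over the directed set of finite subsets of `ℕ`, whose filter is
        -- countably generated; testing along sequences of finite sets brings it within reach of
        -- `hcont`.
        refine tendsto_of_seq_tendsto fun F hF => ?_
        have h1 := hcont (fun n => ⋃ i ∈ F n, f i) (⋃ i, f i)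
          (fun n => (F n).measurableSet_biUnion fun i _ => hf i) (MeasurableSet.iUnion hf) ?_
        · exact h1.congr fun n => by simp [hsum f hf hd]
        · intro ω
          by_cases hω : ∃ i, ω ∈ f i
          · obtain ⟨i, hi⟩ := hω
            filter_upwards [hF.eventually (eventually_ge_atTop {i})] with n hn
            simp only [Set.mem_iUnion]
            exact ⟨fun ⟨j, _, hj⟩ => ⟨j, hj⟩, fun _ => ⟨i, hn (Finset.mem_singleton_self i), hi⟩⟩
          · refine Eventually.of_forall fun n => ?_
            simp only [Set.mem_iUnion]
            exact ⟨fun ⟨j, _, hj⟩ => ⟨j, hj⟩, fun h => (hω h).elim⟩ }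
  have hs : ∀ A, MeasurableSet A → s A = ν A := fun A hA => if_pos hA
  have hac : s ≪ᵥ Q.toENNRealVectorMeasure := by
    refine VectorMeasure.AbsolutelyContinuous.mk fun A hA h => ?_
    rw [hs A hA]
    exact hnull A hA (by rwa [Measure.toENNRealVectorMeasure_apply_measurable hA] at h)
  refine ⟨s.rnDeriv Q, (s.measurable_rnDeriv Q).stronglyMeasurable, s.integrable_rnDeriv Q,
    fun A hA => ?_⟩
  rw [← withDensityᵥ_apply (s.integrable_rnDeriv Q) hA, s.withDensityᵥ_rnDeriv_eq Q hac, hs A hA]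

theorem exists_density_sub {m0 : MeasurableSpace Ω} (hm : m ≤ m0) (Q : Measure[m0] Ω)
    [IsFiniteMeasure Q] (ν : Set Ω → ℝ)
    (hnull : ∀ A, MeasurableSet[m] A → Q A = 0 → ν A = 0)
    (hadd : ∀ A B, MeasurableSet[m] A → MeasurableSet[m] B → Disjoint A B → ν (A ∪ B) = ν A + ν B)
    (hcont : ∀ (A : ℕ → Set Ω) (B : Set Ω), (∀ n, MeasurableSet[m] (A n)) → MeasurableSet[m] B →
      (∀ ω, ∀ᶠ n in atTop, ω ∈ A n ↔ ω ∈ B) → Tendsto (fun n => ν (A n)) atTop (𝓝 (ν B))) :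
    ∃ X : Ω → ℝ, StronglyMeasurable[m] X ∧ Integrable X Q ∧
      ∀ A, MeasurableSet[m] A → ∫ ω in A, X ω ∂Q = ν A := by
  obtain ⟨X, hX, hXi, hXν⟩ := exists_density (Q.trim hm) ν
    (fun A hA h => hnull A hA (by rwa [trim_measurableSet_eq hm hA] at h)) hadd hcont
  refine ⟨X, hX, integrable_of_integrable_trim hm hXi, fun A hA => ?_⟩
  rw [setIntegral_trim hm hX hA, hXν A hA]

end Density

/-! ### Unbounded limits of adapted sequences -/

section Disjoint

theorem eventually_measure_ne_zero {P : Measure Ω} {E : Set Ω} {D : ℕ → Set Ω} (hE : P E ≠ 0)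
    (h : ∀ᵐ ω ∂P, ω ∈ E → ∀ᶠ n in atTop, ω ∈ D n) : ∀ᶠ n in atTop, P (D n) ≠ 0 := by
  by_contra hcon
  refine hE (measure_eq_zero_iff_ae_notMem.2 ?_)
  have h1 : ∀ᵐ ω ∂P, ∀ n, P (D n) = 0 → ω ∉ D n := by
    refine ae_all_iff.2 fun n => ?_
    by_cases hn : P (D n) = 0
    · filter_upwards [measure_eq_zero_iff_ae_notMem.1 hn] with ω hω _ using hω
    · exact Eventually.of_forall fun ω h => (hn h).elim
  filter_upwards [h, h1] with ω h2 h3 hω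
  refine hcon ?_
  filter_upwards [h2 hω] with n hn h0 using h3 n h0 hn

variable {P : Measure Ω} {𝓕 : Filtration ℕ m0} {M : ℕ → Ω → ℝ} {X : Ω → ℝ}

/-- One step of an exhaustion: cut off a non-null piece where the sequence is large, while `X` stays
unbounded on the rest. For late `n'`, the events where `|M n'|` lies between `k` and `b` and where
it exceeds `max k b` are both non-null, and they are disjoint. If removing the first leaves `X`
bounded, then `X` is unbounded on the first, so the second can be removed instead. -/
theorem exists_split (hM : ∀ n, StronglyMeasurable[𝓕 n] (M n))
    (hX : ∀ᵐ ω ∂P, Tendsto (fun n => M n ω) atTop (𝓝 (X ω))) {n : ℕ} {A : Set Ω}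
    (hA : MeasurableSet[𝓕 n] A) (hbad : ∀ C : ℝ, ¬ ∀ᵐ ω ∂P, ω ∈ A → |X ω| ≤ C) (k : ℝ) :
    ∃ n' : ℕ, ∃ D ⊆ A, MeasurableSet[𝓕 n'] D ∧ MeasurableSet[𝓕 n'] (A \ D) ∧ P D ≠ 0 ∧
      (∀ ω ∈ D, k < |M n' ω|) ∧ ∀ C : ℝ, ¬ ∀ᵐ ω ∂P, ω ∈ A \ D → |X ω| ≤ C := by
  obtain ⟨b, hb⟩ : ∃ b : ℕ, P {ω | ω ∈ A ∧ k < |X ω| ∧ |X ω| < b} ≠ 0 := by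
    by_contra! hcon
    refine hbad k ?_
    filter_upwards [ae_all_iff.2 fun b => measure_eq_zero_iff_ae_notMem.1 (hcon b)] with ω hω hωA
    by_contra! hlt
    obtain ⟨b, hb⟩ := exists_nat_gt |X ω|
    exact hω b ⟨hωA, hlt, hb⟩
  have hb' : P {ω | ω ∈ A ∧ max k b < |X ω|} ≠ 0 := by
    intro h0
    refine hbad (max k b) ?_
    filter_upwards [measure_eq_zero_iff_ae_notMem.1 h0] with ω hω hωA
    by_contra! hlt
    exact hω ⟨hωA, hlt⟩
  have e1 := eventually_measure_ne_zero (D := fun n => {ω | ω ∈ A ∧ k < |M n ω| ∧ |M n ω| < b}) hb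
    (by
      filter_upwards [hX] with ω hω h
      filter_upwards [hω.abs.eventually_const_lt h.2.1, hω.abs.eventually_lt_const h.2.2]
        with n h1 h2 using ⟨h.1, h1, h2⟩)
  have e2 := eventually_measure_ne_zero (D := fun n => {ω | ω ∈ A ∧ max k b < |M n ω|}) hb'
    (by
      filter_upwards [hX] with ω hω h
      filter_upwards [hω.abs.eventually_const_lt h.2] with n h1 using ⟨h.1, h1⟩)
  obtain ⟨n', h1, h2, hn'⟩ := (e1.and (e2.and (eventually_ge_atTop n))).exists
  have hAn : MeasurableSet[𝓕 n'] A := 𝓕.mono hn' _ hA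
  have hMn : Measurable[𝓕 n'] fun ω => |M n' ω| :=
    continuous_abs.measurable.comp (hM n').measurable
  have m1 : MeasurableSet[𝓕 n'] {ω | ω ∈ A ∧ k < |M n' ω| ∧ |M n' ω| < b} :=
    hAn.inter ((hMn measurableSet_Ioi).inter (hMn measurableSet_Iio))
  have m2 : MeasurableSet[𝓕 n'] {ω | ω ∈ A ∧ max k b < |M n' ω|} :=
    hAn.inter (hMn measurableSet_Ioi)
  by_cases hcase : ∀ C : ℝ, ¬ ∀ᵐ ω ∂P,
      ω ∈ A \ {ω | ω ∈ A ∧ k < |M n' ω| ∧ |M n' ω| < b} → |X ω| ≤ C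
  · exact ⟨n', _, fun ω h => h.1, m1, hAn.diff m1, h1, fun ω h => h.2.1, hcase⟩
  · push Not at hcase
    obtain ⟨C, hC⟩ := hcase
    refine ⟨n', _, fun ω h => h.1, m2, hAn.diff m2, h2,
      fun ω h => (le_max_left _ _).trans_lt h.2, fun C' hC' => hbad (max C C') ?_⟩
    filter_upwards [hC, hC'] with ω h3 h4 hωA
    by_cases hω : max k b < |M n' ω|
    · exact (h3 ⟨hωA, fun h => (h.2.2.trans_le (le_max_right k b)).not_gt hω⟩).trans
        (le_max_left _ _)
    · exact (h4 ⟨hωA, fun h => hω h.2⟩).trans (le_max_right _ _)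

/-- If an adapted sequence converges to an unbounded limit, then it takes arbitrarily large values
on pairwise disjoint non-null events, each known at the corresponding time. -/
theorem exists_disjoint_large (hM : ∀ n, StronglyMeasurable[𝓕 n] (M n))
    (hX : ∀ᵐ ω ∂P, Tendsto (fun n => M n ω) atTop (𝓝 (X ω)))
    (hunb : ∀ C : ℝ, ¬ ∀ᵐ ω ∂P, |X ω| ≤ C) :
    ∃ (i : ℕ → ℕ) (D : ℕ → Set Ω), (∀ j, MeasurableSet[𝓕 (i j)] (D j)) ∧
      Pairwise (Function.onFun Disjoint D) ∧ (∀ j, P (D j) ≠ 0) ∧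
      ∀ j, ∀ ω ∈ D j, (j : ℝ) < |M (i j) ω| := by
  let St := {p : ℕ × Set Ω // MeasurableSet[𝓕 p.1] p.2 ∧
    ∀ C : ℝ, ¬ ∀ᵐ ω ∂P, ω ∈ p.2 → |X ω| ≤ C}
  have step : ∀ (p : St) (k : ℕ), ∃ n' : ℕ, ∃ D ⊆ p.1.2, MeasurableSet[𝓕 n'] D ∧
      MeasurableSet[𝓕 n'] (p.1.2 \ D) ∧ P D ≠ 0 ∧ (∀ ω ∈ D, (k : ℝ) < |M n' ω|) ∧
      ∀ C : ℝ, ¬ ∀ᵐ ω ∂P, ω ∈ p.1.2 \ D → |X ω| ≤ C :=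
    fun p k => exists_split hM hX p.2.1 p.2.2 k
  choose n' D hDA hD hAD hP hlarge hbad using step
  -- The state is what remains of `Ω` after the pieces already removed, with a time at which it is
  -- known. Later pieces lie in later remainders, hence are disjoint from earlier ones.
  let st : ℕ → St := fun j => Nat.rec (motive := fun _ => St)
    ⟨(0, Set.univ), MeasurableSet.univ, by simpa using hunb⟩
    (fun k p => ⟨(n' p k, p.1.2 \ D p k), hAD p k, hbad p k⟩) j
  have hst : ∀ j, (st (j + 1)).1.2 = (st j).1.2 \ D (st j) j := fun j => rfl
  have hanti : Antitone fun j => (st j).1.2 :=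
    antitone_nat_of_succ_le fun j => (hst j).le.trans Set.sdiff_subset
  refine ⟨fun j => n' (st j) j, fun j => D (st j) j, fun j => hD _ _, ?_, fun j => hP _ _,
    fun j => hlarge _ _⟩
  refine (pairwise_disjoint_on _).2 fun i j hij => ?_
  refine Set.disjoint_right.2 fun ω hj hi => ?_
  have h1 : ω ∈ (st (i + 1)).1.2 := hanti (Nat.succ_le_of_lt hij) (hDA _ _ hj)
  rw [hst] at h1
  exact h1.2 hi

end Disjoint

/-! ### Additivity of the evaluation over events of the larger σ-algebra -/

/-- A conditional evaluation `Φ : L^∞(𝓓) → L^∞(𝓐)` which is a `Q`-conditional expectation of each of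
the conditional evaluations `Ψ n : L^∞(𝓓) → L^∞(𝓕 n)` and of each payoff in `L^∞(𝓖)`, where the
`σ`-algebras `𝓕 n` increase to `𝓖` up to null sets. -/
structure IsRefinedBy (P Q : Measure Ω) (𝓓 𝓖 𝓐 : MeasurableSpace Ω) (𝓕 : Filtration ℕ m0)
    (Φ : (Ω → ℝ) → Ω → ℝ) (Ψ : ℕ → (Ω → ℝ) → Ω → ℝ) : Prop where
  ac : Q ≪ P
  ac' : P ≪ Q
  le_base : 𝓓 ≤ m0
  le_domain : 𝓖 ≤ 𝓓
  le_range : 𝓐 ≤ 𝓖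
  le_filtration : ∀ n, 𝓐 ≤ 𝓕 n
  filtration_le : ∀ n, 𝓕 n ≤ 𝓓
  eval : IsCondEvaluation P 𝓓 𝓐 Φ
  eval_refined : ∀ n, IsCondEvaluation P 𝓓 (𝓕 n) (Ψ n)
  condExp_refined : ∀ n H, MemLinf P 𝓓 H → Φ H =ᵐ[P] Q[Ψ n H | 𝓐]
  market : ∀ h H, MemLinf P 𝓖 h → MemLinf P 𝓓 H → Φ (h + H) =ᵐ[P] Q[h | 𝓐] + Φ H
  aeLe_iSup : SigmaAELe P 𝓖 (⨆ n, 𝓕 n)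
  filtration_aeLe : ∀ n, SigmaAELe P (𝓕 n) 𝓖
  bounded : ∀ H, MemLinf P 𝓓 H → ∀ (i : ℕ → ℕ) (D : ℕ → Set Ω),
    (∀ j, MeasurableSet[𝓕 (i j)] (D j)) → Pairwise (Function.onFun Disjoint D) →
    ∃ C : ℝ, ∀ j, ∀ᵐ ω ∂P, ω ∈ D j → |Ψ (i j) H ω| ≤ C

namespace IsRefinedBy

variable {P Q : Measure Ω} {𝓕 : Filtration ℕ m0} {Φ : (Ω → ℝ) → Ω → ℝ}
  {Ψ : ℕ → (Ω → ℝ) → Ω → ℝ} {H H₁ H₂ : Ω → ℝ} {A : Set Ω}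

theorem memLinf_indicator (h : IsRefinedBy P Q 𝓓 𝓖 𝓐 𝓕 Φ Ψ) (hH : MemLinf P 𝓓 H)
    (hA : MeasurableSet[𝓖] A) : MemLinf P 𝓓 (A.indicator H) := hH.indicator (h.le_domain _ hA)

theorem integrable [IsFiniteMeasure Q] (h : IsRefinedBy P Q 𝓓 𝓖 𝓐 𝓕 Φ Ψ) (hH : MemLinf P 𝓓 H) :
    Integrable (Φ H) Q :=
  (h.eval.mapsTo H hH).integrable (h.le_range.trans (h.le_domain.trans h.le_base)) h.ac

theorem integrable_refined [IsFiniteMeasure Q] (h : IsRefinedBy P Q 𝓓 𝓖 𝓐 𝓕 Φ Ψ)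
    (hH : MemLinf P 𝓓 H) (n : ℕ) : Integrable (Ψ n H) Q :=
  ((h.eval_refined n).mapsTo H hH).integrable (𝓕.le n) h.ac

/-- `Ψ n` is local over `𝓕 n`, hence additive over the two pieces, and `Φ` is a linear image of `Ψ
n`. -/
theorem add_of_measurable_refined [IsFiniteMeasure Q] (h : IsRefinedBy P Q 𝓓 𝓖 𝓐 𝓕 Φ Ψ)
    (h₁ : MemLinf P 𝓓 H₁) (h₂ : MemLinf P 𝓓 H₂) {n : ℕ} (hA : MeasurableSet[𝓕 n] A) :
    Φ (A.indicator H₁ + Aᶜ.indicator H₂) =ᵐ[P] Φ (A.indicator H₁) + Φ (Aᶜ.indicator H₂) := by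
  have hA1 := h₁.indicator (h.filtration_le n _ hA)
  have hA2 := h₂.indicator (h.filtration_le n _ hA.compl)
  have e1 := h.condExp_refined n _ (hA1.add hA2)
  have e2 : Ψ n (A.indicator H₁ + Aᶜ.indicator H₂)
      =ᵐ[Q] Ψ n (A.indicator H₁) + Ψ n (Aᶜ.indicator H₂) := by
    refine h.ac.ae_eq ?_
    filter_upwards [(h.eval_refined n).localProperty H₁ H₂ h₁ h₂ A hA,
      (h.eval_refined n).indicator h₁ hA, (h.eval_refined n).indicator h₂ hA.compl] with ω a b c
    simp only [a, Pi.add_apply, b, c]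
  have e3 := (condExp_congr_ae (m := 𝓐) e2).trans
    (condExp_add (h.integrable_refined hA1 n) (h.integrable_refined hA2 n) 𝓐)
  filter_upwards [e1, h.ac'.ae_eq e3, h.condExp_refined n _ hA1, h.condExp_refined n _ hA2]
    with ω a b c d
  rw [a, b, Pi.add_apply, Pi.add_apply, c, d]

/-- By Lévy's upward theorem the conditional probabilities of the event given `𝓕 n` tend to its
indicator; cutting at `1 / 2` gives approximating events. -/
theorem exists_approx [IsProbabilityMeasure Q] (h : IsRefinedBy P Q 𝓓 𝓖 𝓐 𝓕 Φ Ψ)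
    (hA : MeasurableSet[𝓖] A) : ∃ B : ℕ → Set Ω, (∀ n, MeasurableSet[𝓕 n] (B n)) ∧
      ∀ᵐ ω ∂P, ∀ᶠ n in atTop, ω ∈ B n ↔ ω ∈ A := by
  obtain ⟨A', hA', hAA'⟩ := h.aeLe_iSup A hA
  have hle : (⨆ n, (𝓕 n : MeasurableSpace Ω)) ≤ m0 := iSup_le fun n => 𝓕.le n
  have hlim := Integrable.tendsto_ae_condExp (μ := Q) (ℱ := 𝓕) (g := A'.indicator fun _ => (1 : ℝ))
    ((integrable_const 1).indicator (hle _ hA')) (stronglyMeasurable_const.indicator hA')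
  refine ⟨fun n => {ω | 1 / 2 < (Q[A'.indicator fun _ => (1 : ℝ) | 𝓕 n]) ω}, fun n =>
    stronglyMeasurable_condExp.measurable measurableSet_Ioi, ?_⟩
  filter_upwards [h.ac'.ae_le hlim, hAA'] with ω hω h1
  have h1' : (ω ∈ A) = (ω ∈ A') := h1
  rw [h1']
  by_cases hωA : ω ∈ A'
  · rw [Set.indicator_of_mem hωA] at hω
    filter_upwards [hω.eventually_const_lt (show (1 / 2 : ℝ) < 1 by norm_num)] with n hn
    simpa [hωA] using hn
  · rw [Set.indicator_of_notMem hωA] at hω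
    filter_upwards [hω.eventually_lt_const (show (0 : ℝ) < 1 / 2 by norm_num)] with n hn
    simpa [hωA] using hn.le

theorem tendsto_indicator_add {B : ℕ → Set Ω} {ω : Ω} (h : ∀ᶠ n in atTop, ω ∈ B n ↔ ω ∈ A)
    (H₁ H₂ : Ω → ℝ) : Tendsto (fun n => ((B n).indicator H₁ + (B n)ᶜ.indicator H₂) ω) atTop
      (𝓝 ((A.indicator H₁ + Aᶜ.indicator H₂) ω)) := by
  refine tendsto_const_nhds.congr' ?_
  filter_upwards [h] with n hn
  by_cases hω : ω ∈ A
  · simp [hω, hn.2 hω]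
  · simp [hω, mt hn.1 hω]

theorem abs_indicator_add_le {B : Set Ω} {ω : Ω} {C₁ C₂ : ℝ} (h₁ : |H₁ ω| ≤ C₁) (h₂ : |H₂ ω| ≤ C₂) :
    |(B.indicator H₁ + Bᶜ.indicator H₂) ω| ≤ max C₁ C₂ := by
  by_cases hω : ω ∈ B
  · simpa [hω] using Or.inl h₁
  · simpa [hω] using Or.inr h₂

/-- The lower semicontinuity of `Φ` along pastings over convergent events. -/
theorem eventually_lt_paste (h : IsRefinedBy P Q 𝓓 𝓖 𝓐 𝓕 Φ Ψ) (h₁ : MemLinf P 𝓓 H₁)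
    (h₂ : MemLinf P 𝓓 H₂) {B : ℕ → Set Ω} (hB : ∀ n, MeasurableSet[𝓓] (B n))
    (hA : MeasurableSet[𝓓] A) (hlim : ∀ᵐ ω ∂P, ∀ᶠ n in atTop, ω ∈ B n ↔ ω ∈ A) :
    ∀ᵐ ω ∂P, ∀ ε > 0, ∀ᶠ n in atTop, Φ (A.indicator H₁ + Aᶜ.indicator H₂) ω - ε <
      Φ ((B n).indicator H₁ + (B n)ᶜ.indicator H₂) ω := by
  obtain ⟨C₁, hC₁⟩ := h₁.2
  obtain ⟨C₂, hC₂⟩ := h₂.2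
  refine h.eval.eventually_lt (C := max C₁ C₂)
    (fun n => (h₁.indicator (hB n)).add (h₂.indicator (hB n).compl))
    ((h₁.indicator hA).add (h₂.indicator hA.compl)) (fun n => ?_) ?_
  · filter_upwards [hC₁, hC₂] with ω a b using abs_indicator_add_le a b
  · filter_upwards [hlim] with ω hω using tendsto_indicator_add hω _ _

theorem eventually_lt_indicator (h : IsRefinedBy P Q 𝓓 𝓖 𝓐 𝓕 Φ Ψ) (hH : MemLinf P 𝓓 H)
    {B : ℕ → Set Ω} (hB : ∀ n, MeasurableSet[𝓓] (B n))
    (hA : MeasurableSet[𝓓] A) (hlim : ∀ᵐ ω ∂P, ∀ᶠ n in atTop, ω ∈ B n ↔ ω ∈ A) :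
    ∀ᵐ ω ∂P, ∀ ε > 0, ∀ᶠ n in atTop, Φ (A.indicator H) ω - ε < Φ ((B n).indicator H) ω := by
  simpa using h.eventually_lt_paste hH MemLinf.zero hB hA hlim

theorem eventually_compl {B : ℕ → Set Ω} (hlim : ∀ᵐ ω ∂P, ∀ᶠ n in atTop, ω ∈ B n ↔ ω ∈ A) :
    ∀ᵐ ω ∂P, ∀ᶠ n in atTop, ω ∈ (B n)ᶜ ↔ ω ∈ Aᶜ := by
  filter_upwards [hlim] with ω hω
  filter_upwards [hω] with n hn using not_congr hn

/-- `Φ` is additive over events of `𝓖`, and not only over those of `𝓐`. -/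
theorem add_of_measurable [IsProbabilityMeasure Q] (h : IsRefinedBy P Q 𝓓 𝓖 𝓐 𝓕 Φ Ψ)
    (h₁ : MemLinf P 𝓓 H₁) (h₂ : MemLinf P 𝓓 H₂) (hA : MeasurableSet[𝓖] A) :
    Φ (A.indicator H₁ + Aᶜ.indicator H₂) =ᵐ[P] Φ (A.indicator H₁) + Φ (Aᶜ.indicator H₂) := by
  obtain ⟨B, hB, hlim⟩ := h.exists_approx hA
  have hBD := fun n => h.filtration_le n _ (hB n)
  have hAD := h.le_domain _ hA
  have hlimc := eventually_compl hlim
  have split : ∀ {K : Ω → ℝ}, MemLinf P 𝓓 K → ∀ᵐ ω ∂P, ∀ n,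
      Φ ((B n).indicator K) ω + Φ ((B n)ᶜ.indicator K) ω = Φ K ω := fun {K} hK => by
    refine ae_all_iff.2 fun n => ?_
    have := h.add_of_measurable_refined hK hK (hB n)
    rw [Set.indicator_self_add_compl] at this
    filter_upwards [this] with ω hω using hω.symm
  have low : ∀ {K : Ω → ℝ}, MemLinf P 𝓓 K → ∀ᵐ ω ∂P, ∀ ε > 0, ∀ᶠ n in atTop,
      Φ (A.indicator K) ω - ε < Φ ((B n).indicator K) ω :=
    fun hK => h.eventually_lt_indicator hK hBD hAD hlim
  have lowc : ∀ {K : Ω → ℝ}, MemLinf P 𝓓 K → ∀ᵐ ω ∂P, ∀ ε > 0, ∀ᶠ n in atTop,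
      Φ (Aᶜ.indicator K) ω - ε < Φ ((B n)ᶜ.indicator K) ω :=
    fun hK => h.eventually_lt_indicator hK (fun n => (hBD n).compl) hAD.compl hlimc
  have m₁ : MemLinf P 𝓓 (A.indicator H₁) := h₁.indicator hAD
  have m₂ : MemLinf P 𝓓 (Aᶜ.indicator H₂) := h₂.indicator hAD.compl
  have i₁ : A.indicator (A.indicator H₁ + Aᶜ.indicator H₂) = A.indicator H₁ := by
    ext ω; by_cases hω : ω ∈ A <;> simp [hω]
  have i₂ : Aᶜ.indicator (A.indicator H₁ + Aᶜ.indicator H₂) = Aᶜ.indicator H₂ := by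
    ext ω; by_cases hω : ω ∈ A <;> simp [hω]
  have i₃ : A.indicator (A.indicator H₁) = A.indicator H₁ := by
    ext ω; by_cases hω : ω ∈ A <;> simp [hω]
  have i₄ : Aᶜ.indicator (A.indicator H₁) = 0 := by
    ext ω; by_cases hω : ω ∈ A <;> simp [hω]
  have i₅ : Aᶜ.indicator (Aᶜ.indicator H₂) = Aᶜ.indicator H₂ := by
    ext ω; by_cases hω : ω ∈ A <;> simp [hω]
  have i₆ : A.indicator (Aᶜ.indicator H₂) = 0 := by
    ext ω; by_cases hω : ω ∈ A <;> simp [hω]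
  have l1 := low (m₁.add m₂)
  have l2 := lowc (m₁.add m₂)
  have l3 := low m₁
  have l4 := lowc m₁
  have l5 := low m₂
  have l6 := lowc m₂
  rw [i₁] at l1
  rw [i₂] at l2
  rw [i₃] at l3
  rw [i₄] at l4
  rw [i₆] at l5
  rw [i₅] at l6
  have paste := h.eventually_lt_paste m₁ m₂ hBD hAD hlim
  rw [i₃, i₅] at paste
  have addB : ∀ᵐ ω ∂P, ∀ n, Φ ((B n).indicator (A.indicator H₁) + (B n)ᶜ.indicator (Aᶜ.indicator H₂)) ω
      = Φ ((B n).indicator (A.indicator H₁)) ω + Φ ((B n)ᶜ.indicator (Aᶜ.indicator H₂)) ω :=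
    ae_all_iff.2 fun n => h.add_of_measurable_refined m₁ m₂ (hB n)
  filter_upwards [split (m₁.add m₂), split m₁, split m₂, l1, l2, l3, l4, l5, l6, paste, addB,
    h.eval.normalized] with ω s s1 s2 l1 l2 l3 l4 l5 l6 paste addB h0
  rw [h0] at l4 l5
  rw [Pi.add_apply]
  -- Superadditivity: the pieces over `B n` and its complement have constant sum, and Fatou bounds
  -- each piece from below in the limit.
  refine le_antisymm ?_ (add_le_of_eventually_lt s l1 l2)
  -- For the other inequality, split each of the two pasted payoffs along `B n`. The unwanted part
  -- has lower limit at least `Φ 0 = 0`, so the wanted part converges to the full value, and Fatou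
  -- for the pasting over `B n` concludes.
  have t1 := tendsto_of_eventually_lt (b := 0) (by simpa using s1) l3 l4
  have t2 := tendsto_of_eventually_lt (b := 0) (fun n => by rw [add_comm, s2 n, add_zero]) l6 l5
  refine le_of_forall_pos_le_add fun ε hε => ?_
  have t3 : ∀ᶠ n in atTop, Φ (A.indicator H₁ + Aᶜ.indicator H₂) ω - ε ≤
      Φ ((B n).indicator (A.indicator H₁)) ω + Φ ((B n)ᶜ.indicator (Aᶜ.indicator H₂)) ω := by
    filter_upwards [paste ε hε] with n hn
    rw [← addB n]
    exact hn.le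
  linarith [ge_of_tendsto (t1.add t2) t3]

/-- Fatou bounds the pieces over `B n` and its complement from below, and additivity over 𝓖 makes
their sum the constant `Φ H`. -/
theorem tendsto_indicator_apply [IsProbabilityMeasure Q] (h : IsRefinedBy P Q 𝓓 𝓖 𝓐 𝓕 Φ Ψ)
    (hH : MemLinf P 𝓓 H) {B : ℕ → Set Ω} (hB : ∀ n, MeasurableSet[𝓖] (B n))
    (hA : MeasurableSet[𝓖] A) (hlim : ∀ᵐ ω ∂P, ∀ᶠ n in atTop, ω ∈ B n ↔ ω ∈ A) :
    ∀ᵐ ω ∂P, Tendsto (fun n => Φ ((B n).indicator H) ω) atTop (𝓝 (Φ (A.indicator H) ω)) := by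
  have split : ∀ {B : Set Ω}, MeasurableSet[𝓖] B → ∀ᵐ ω ∂P,
      Φ (B.indicator H) ω + Φ (Bᶜ.indicator H) ω = Φ H ω := fun {B} hB => by
    have := h.add_of_measurable hH hH hB
    rw [Set.indicator_self_add_compl] at this
    filter_upwards [this] with ω hω using hω.symm
  filter_upwards [ae_all_iff.2 fun n => split (hB n), split hA,
    h.eventually_lt_indicator hH (fun n => h.le_domain _ (hB n)) (h.le_domain _ hA) hlim,
    h.eventually_lt_indicator hH (fun n => (h.le_domain _ (hB n)).compl) (h.le_domain _ hA).compl
      (eventually_compl hlim)] with ω s1 s2 l1 l2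
  exact tendsto_of_eventually_lt (fun n => by rw [s1 n, s2]) l1 l2

end IsRefinedBy

/-- An evaluation which is pointwise bounded along a bounded sequence is uniformly bounded. -/
theorem IsCondEvaluation.exists_bound {P : Measure Ω} {Φ : (Ω → ℝ) → Ω → ℝ}
    (h : IsCondEvaluation P 𝓓 𝓐 Φ) (hle : 𝓐 ≤ 𝓓) {F : ℕ → Ω → ℝ} (hF : ∀ n, MemLinf P 𝓓 (F n))
    {C : ℝ} (hC : ∀ n, ∀ᵐ ω ∂P, |F n ω| ≤ C)
    (hbdd : ∀ᵐ ω ∂P, BddAbove (Set.range fun n => |Φ (F n) ω|)) :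
    ∃ K : ℝ, ∀ n, ∀ᵐ ω ∂P, |Φ (F n) ω| ≤ K := by
  choose y hy hyΦ using fun n => (h.mapsTo _ (hF n)).1
  have hyabs : ∀ n, Measurable[𝓐] fun ω => |y n ω| := fun n =>
    continuous_abs.measurable.comp (hy n).measurable
  let W : Ω → ℝ := fun ω => ⨆ n, |y n ω|
  have hW : Measurable[𝓐] W := Measurable.iSup hyabs
  -- On `E n` the `n`-th value is within 1 of the supremum, and these events cover wherever the
  -- supremum is finite. Gluing the `F n` along them gives one bounded payoff, whose evaluation is
  -- bounded and dominates the supremum up to 1.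
  let E : ℕ → Set Ω := fun n => {ω | W ω < |y n ω| + 1}
  have hE : ∀ n, MeasurableSet[𝓐] (E n) := fun n => measurableSet_lt hW ((hyabs n).add_const 1)
  have hC0 : ∀ᵐ ω ∂P, |(0 : Ω → ℝ) ω| ≤ C := by
    filter_upwards [hC 0] with ω hω
    simpa using (abs_nonneg _).trans hω
  obtain ⟨K, hK, -, hKF, -⟩ := exists_memLinf_glue
    (fun n => hle _ (MeasurableSet.disjointed hE n)) (disjoint_disjointed E) hF MemLinf.zero hC hC0
  obtain ⟨L, hL⟩ := (h.mapsTo K hK).2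
  have heq : ∀ᵐ ω ∂P, ∀ n, ω ∈ disjointed E n → Φ K ω = Φ (F n) ω := ae_all_iff.2 fun n =>
    h.ae_eq_on hle hK (hF n) (MeasurableSet.disjointed hE n) (Eventually.of_forall (hKF n))
  refine ⟨L + 1, fun n => ?_⟩
  filter_upwards [hbdd, hL, heq, ae_all_iff.2 hyΦ] with ω h1 h2 h3 h4
  simp only [h4] at h1 h3 ⊢
  have hlt : W ω - 1 < ⨆ n, |y n ω| := sub_one_lt _
  obtain ⟨k, hk⟩ := exists_lt_of_lt_ciSup hlt
  have hmem : ω ∈ ⋃ n, disjointed E n := by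
    rw [iUnion_disjointed]
    exact Set.mem_iUnion.2 ⟨k, by simpa [E] using sub_lt_iff_lt_add.1 hk⟩
  obtain ⟨j, hj⟩ := Set.mem_iUnion.1 hmem
  have hjE : W ω < |y j ω| + 1 := disjointed_subset E j hj
  rw [h3 j hj] at h2
  have := le_ciSup h1 n
  change |y n ω| ≤ W ω at this
  linarith

/-! ### Local densities and their properties -/

/-- `X` is the `Q`-density on `𝓖` of the set function `A ↦ E_Q[Φ(1_A H)]`. -/
structure IsLocalDensity (Q : Measure Ω) (𝓖 : MeasurableSpace Ω) (Φ : (Ω → ℝ) → Ω → ℝ)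
    (H X : Ω → ℝ) : Prop where
  stronglyMeasurable : StronglyMeasurable[𝓖] X
  integrable : Integrable X Q
  setIntegral : ∀ A, MeasurableSet[𝓖] A → ∫ ω in A, X ω ∂Q = ∫ ω, Φ (A.indicator H) ω ∂Q

theorem ae_le_of_forall_setIntegral_le_sub (hm : m ≤ m0) {Q : Measure Ω} {X₁ X₂ : Ω → ℝ}
    (h₁ : StronglyMeasurable[m] X₁) (h₂ : StronglyMeasurable[m] X₂) (i₁ : Integrable X₁ Q)
    (i₂ : Integrable X₂ Q)
    (h : ∀ A, MeasurableSet[m] A → ∫ ω in A, X₁ ω ∂Q ≤ ∫ ω in A, X₂ ω ∂Q) : X₁ ≤ᵐ[Q] X₂ := by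
  refine ae_le_of_ae_le_trim (hm := hm) (ae_le_of_forall_setIntegral_le (i₁.trim hm h₁)
    (i₂.trim hm h₂) fun A hA _ => ?_)
  rw [← setIntegral_trim hm h₁ hA, ← setIntegral_trim hm h₂ hA]
  exact h A hA

theorem ae_eq_of_forall_setIntegral_eq_sub (hm : m ≤ m0) {Q : Measure Ω} {X₁ X₂ : Ω → ℝ}
    (h₁ : StronglyMeasurable[m] X₁) (h₂ : StronglyMeasurable[m] X₂) (i₁ : Integrable X₁ Q)
    (i₂ : Integrable X₂ Q)
    (h : ∀ A, MeasurableSet[m] A → ∫ ω in A, X₁ ω ∂Q = ∫ ω in A, X₂ ω ∂Q) : X₁ =ᵐ[Q] X₂ :=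
  (ae_le_of_forall_setIntegral_le_sub hm h₁ h₂ i₁ i₂ fun A hA => (h A hA).le).antisymm
    (ae_le_of_forall_setIntegral_le_sub hm h₂ h₁ i₂ i₁ fun A hA => (h A hA).ge)

namespace IsRefinedBy

variable {P Q : Measure Ω} {𝓕 : Filtration ℕ m0} {Φ : (Ω → ℝ) → Ω → ℝ}
  {Ψ : ℕ → (Ω → ℝ) → Ω → ℝ} {H H₁ H₂ X X₁ X₂ : Ω → ℝ} {A : Set Ω}

theorem le (h : IsRefinedBy P Q 𝓓 𝓖 𝓐 𝓕 Φ Ψ) : 𝓖 ≤ m0 := h.le_domain.trans h.le_base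

/-- Additivity comes from `add_of_measurable`. Continuity along events is dominated convergence:
`tendsto_indicator_apply` gives the limit and `IsCondEvaluation.exists_bound` the constant
dominating function. -/
theorem exists_isLocalDensity [IsProbabilityMeasure Q] (h : IsRefinedBy P Q 𝓓 𝓖 𝓐 𝓕 Φ Ψ)
    (hH : MemLinf P 𝓓 H) : ∃ X, IsLocalDensity Q 𝓖 Φ H X := by
  refine (exists_density_sub h.le Q (fun A => ∫ ω, Φ (A.indicator H) ω ∂Q) ?_ ?_ ?_).imp
    fun X hX => ⟨hX.1, hX.2.1, hX.2.2⟩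
  · intro A hA hQA
    have h0 : A.indicator H =ᵐ[P] 0 := indicator_meas_zero (h.ac' hQA)
    have h1 := (h.eval.congr _ _ (h.memLinf_indicator hH hA) MemLinf.zero h0).trans
      h.eval.normalized
    rw [integral_congr_ae (h.ac.ae_eq h1)]
    simp
  · intro A B hA hB hAB
    have h1 : (A ∪ B).indicator H = A.indicator H + Aᶜ.indicator (B.indicator H) := by
      ext ω
      by_cases hωA : ω ∈ A
      · simp [hωA]
      · by_cases hωB : ω ∈ B <;> simp [hωA, hωB]
    have h2 : Aᶜ.indicator (B.indicator H) = B.indicator H := by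
      ext ω
      by_cases hωA : ω ∈ A
      · simp [hωA, Set.disjoint_left.1 hAB hωA]
      · simp [hωA]
    have h3 := h.add_of_measurable hH (h.memLinf_indicator hH hB) hA
    rw [← h1, h2] at h3
    rw [integral_congr_ae (h.ac.ae_eq h3)]
    exact integral_add (h.integrable (h.memLinf_indicator hH hA))
      (h.integrable (h.memLinf_indicator hH hB))
  · intro B A hB hA hlim
    have ht := h.tendsto_indicator_apply hH hB hA (Eventually.of_forall hlim)
    obtain ⟨C, hC⟩ := hH.2
    obtain ⟨K, hK⟩ := h.eval.exists_bound (h.le_range.trans h.le_domain)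
      (fun n => h.memLinf_indicator hH (hB n)) (C := C) (fun n => by
        filter_upwards [hC] with ω hω
        by_cases hωB : ω ∈ B n
        · simpa [hωB] using hω
        · simpa [hωB] using (abs_nonneg _).trans hω)
      (by filter_upwards [ht] with ω hω using hω.abs.bddAbove_range)
    exact tendsto_integral_of_dominated_convergence (fun _ => K)
      (fun n => (h.integrable (h.memLinf_indicator hH (hB n))).aestronglyMeasurable)
      (integrable_const K) (fun n => h.ac.ae_le (hK n)) (h.ac.ae_le ht)

/-- For `A` in `𝓕 n`, the integral of `X` over `A` is `E_Q[Φ(1_A H)] = E_Q[Ψ n (1_A H)]`, and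
locality of `Ψ n` takes the indicator out. As `A` belongs to 𝓖 only up to a null set, it is first
replaced by a version `B`. -/
theorem condExp_filtration [IsProbabilityMeasure Q] (h : IsRefinedBy P Q 𝓓 𝓖 𝓐 𝓕 Φ Ψ)
    (hH : MemLinf P 𝓓 H) (hX : IsLocalDensity Q 𝓖 Φ H X) (n : ℕ) : Q[X | 𝓕 n] =ᵐ[Q] Ψ n H := by
  refine (ae_eq_condExp_of_forall_setIntegral_eq (𝓕.le n) hX.integrable
    (fun A _ _ => (h.integrable_refined hH n).integrableOn) (fun A hA _ => ?_) ?_).symm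
  · obtain ⟨B, hB, hAB⟩ := h.filtration_aeLe n A hA
    have hAD := hH.indicator (h.filtration_le n _ hA)
    have h1 : A.indicator H =ᵐ[P] B.indicator H := indicator_ae_eq_of_ae_eq_set hAB
    have h2 := h.eval.congr _ _ hAD (h.memLinf_indicator hH hB) h1
    have h3 := h2.symm.trans (h.condExp_refined n _ hAD)
    rw [setIntegral_congr_set (h.ac.ae_eq hAB), setIntegral_congr_set (h.ac.ae_eq hAB),
      hX.setIntegral B hB, integral_congr_ae (h.ac.ae_eq h3),
      integral_condExp (h.le_range.trans h.le),
      integral_congr_ae (h.ac.ae_eq ((h.eval_refined n).indicator hH hA)),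
      integral_indicator (𝓕.le n _ hA), setIntegral_congr_set (h.ac.ae_eq hAB)]
  · obtain ⟨g, hg, hfg⟩ := ((h.eval_refined n).mapsTo H hH).1
    exact ⟨g, hg, h.ac.ae_eq hfg⟩

theorem condExp_range [IsProbabilityMeasure Q] (h : IsRefinedBy P Q 𝓓 𝓖 𝓐 𝓕 Φ Ψ)
    (hH : MemLinf P 𝓓 H) (hX : IsLocalDensity Q 𝓖 Φ H X) : Φ H =ᵐ[P] Q[X | 𝓐] := by
  have h1 := (condExp_congr_ae (m := 𝓐) (h.condExp_filtration hH hX 0)).symm.trans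
    (condExp_condExp_of_le (h.le_filtration 0) (𝓕.le 0))
  exact (h.condExp_refined 0 H hH).trans (h.ac'.ae_eq h1)

/-- The martingale `Ψ n H` converges almost surely to `X`. Were `X` unbounded, it would exceed every
`j` on disjoint non-null events known at the respective times, against the field `bounded`. -/
theorem memLinf_density [IsProbabilityMeasure Q] (h : IsRefinedBy P Q 𝓓 𝓖 𝓐 𝓕 Φ Ψ)
    (hH : MemLinf P 𝓓 H) (hX : IsLocalDensity Q 𝓖 Φ H X) : MemLinf P 𝓖 X := by
  refine ⟨⟨X, hX.stronglyMeasurable, EventuallyEq.rfl⟩, ?_⟩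
  by_contra hunb
  rw [not_exists] at hunb
  obtain ⟨g, hg, hXg⟩ := h.aeLe_iSup.aestronglyMeasurable (P := P)
    ⟨X, hX.stronglyMeasurable, EventuallyEq.rfl⟩
  have hlim := Integrable.tendsto_ae_condExp (ℱ := 𝓕)
    (hX.integrable.congr (h.ac.ae_eq hXg)) hg
  choose y hy hyΨ using fun n => ((h.eval_refined n).mapsTo H hH).1
  have hyX : ∀ᵐ ω ∂P, Tendsto (fun n => y n ω) atTop (𝓝 (X ω)) := by
    have h1 : ∀ᵐ ω ∂P, ∀ n, (Q[g | 𝓕 n]) ω = Ψ n H ω := ae_all_iff.2 fun n =>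
      h.ac'.ae_eq ((condExp_congr_ae (h.ac.ae_eq hXg)).symm.trans (h.condExp_filtration hH hX n))
    filter_upwards [h.ac'.ae_le hlim, h1, ae_all_iff.2 hyΨ, hXg] with ω a b c d
    rw [d]
    exact a.congr fun n => by rw [b, c]
  obtain ⟨i, D, hD, hdisj, hne, hlarge⟩ := exists_disjoint_large hy hyX hunb
  obtain ⟨C, hC⟩ := h.bounded H hH i D hD hdisj
  obtain ⟨j, hj⟩ := exists_nat_ge C
  refine hne j (measure_eq_zero_iff_ae_notMem.2 ?_)
  filter_upwards [hC j, hyΨ (i j)] with ω h1 h2 hω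
  have h3 := h1 hω
  rw [h2] at h3
  linarith [hlarge j ω hω]

theorem density_congr (h : IsRefinedBy P Q 𝓓 𝓖 𝓐 𝓕 Φ Ψ) (h₁ : MemLinf P 𝓓 H₁)
    (h₂ : MemLinf P 𝓓 H₂) (hX₁ : IsLocalDensity Q 𝓖 Φ H₁ X₁) (hX₂ : IsLocalDensity Q 𝓖 Φ H₂ X₂)
    (heq : H₁ =ᵐ[P] H₂) : X₁ =ᵐ[P] X₂ := by
  refine h.ac'.ae_eq (ae_eq_of_forall_setIntegral_eq_sub h.le hX₁.stronglyMeasurable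
    hX₂.stronglyMeasurable hX₁.integrable hX₂.integrable fun A hA => ?_)
  rw [hX₁.setIntegral A hA, hX₂.setIntegral A hA]
  refine integral_congr_ae (h.ac.ae_eq (h.eval.congr _ _ (h.memLinf_indicator h₁ hA)
    (h.memLinf_indicator h₂ hA) ?_))
  filter_upwards [heq] with ω hω
  by_cases hωA : ω ∈ A <;> simp [hωA, hω]

theorem density_zero (h : IsRefinedBy P Q 𝓓 𝓖 𝓐 𝓕 Φ Ψ) (hX : IsLocalDensity Q 𝓖 Φ 0 X) :
    X =ᵐ[P] 0 := by
  refine h.ac'.ae_eq (ae_eq_of_forall_setIntegral_eq_sub h.le hX.stronglyMeasurable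
    stronglyMeasurable_zero hX.integrable (integrable_zero _ _ _) fun A hA => ?_)
  rw [hX.setIntegral A hA, Set.indicator_zero', integral_congr_ae (h.ac.ae_eq h.eval.normalized)]
  simp

/-- The payoff `1_A c` is hedgeable, so `market` splits it off, and its conditional expectation
integrates to the integral of `c` over `A`. -/
theorem density_add [IsProbabilityMeasure Q] (h : IsRefinedBy P Q 𝓓 𝓖 𝓐 𝓕 Φ Ψ)
    (hH : MemLinf P 𝓓 H) {c : Ω → ℝ} (hc : MemLinf P 𝓖 c) (hX : IsLocalDensity Q 𝓖 Φ H X)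
    (hX₁ : IsLocalDensity Q 𝓖 Φ (H + c) X₁) : X₁ =ᵐ[P] X + c := by
  obtain ⟨g, hg, hcg⟩ := hc.1
  have hgi : Integrable g Q := (hc.integrable h.le h.ac).congr (h.ac.ae_eq hcg)
  refine EventuallyEq.trans (h.ac'.ae_eq (g := X + g) (ae_eq_of_forall_setIntegral_eq_sub h.le
    hX₁.stronglyMeasurable (hX.stronglyMeasurable.add hg) hX₁.integrable (hX.integrable.add hgi)
    fun A hA => ?_)) (EventuallyEq.rfl.add hcg.symm)
  have hcA : MemLinf P 𝓖 (A.indicator c) := hc.indicator hA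
  have h1 := h.market _ _ hcA (h.memLinf_indicator hH hA)
  have h2 : A.indicator (H + c) = A.indicator c + A.indicator H := by
    rw [Set.indicator_add', add_comm]
  rw [hX₁.setIntegral A hA, h2, integral_congr_ae (h.ac.ae_eq h1),
    integral_add' integrable_condExp (h.integrable (h.memLinf_indicator hH hA)),
    integral_condExp (h.le_range.trans h.le), integral_add' hX.integrable.integrableOn
      hgi.integrableOn, hX.setIntegral A hA, integral_indicator (h.le _ hA),
    setIntegral_congr_ae (h.le _ hA) ((h.ac.ae_eq hcg).mono fun ω hω _ => hω), add_comm]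

theorem density_paste [IsProbabilityMeasure Q] (h : IsRefinedBy P Q 𝓓 𝓖 𝓐 𝓕 Φ Ψ)
    (h₁ : MemLinf P 𝓓 H₁) (h₂ : MemLinf P 𝓓 H₂) (hA : MeasurableSet[𝓖] A)
    (hX₁ : IsLocalDensity Q 𝓖 Φ H₁ X₁) (hX₂ : IsLocalDensity Q 𝓖 Φ H₂ X₂)
    (hX : IsLocalDensity Q 𝓖 Φ (A.indicator H₁ + Aᶜ.indicator H₂) X) :
    X =ᵐ[P] A.indicator X₁ + Aᶜ.indicator X₂ := by
  have hA0 := h.le _ hA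
  refine h.ac'.ae_eq (ae_eq_of_forall_setIntegral_eq_sub h.le hX.stronglyMeasurable
    ((hX₁.stronglyMeasurable.indicator hA).add (hX₂.stronglyMeasurable.indicator hA.compl))
    hX.integrable ((hX₁.integrable.indicator hA0).add (hX₂.integrable.indicator hA0.compl))
    fun B hB => ?_)
  have e1 : B.indicator (A.indicator H₁ + Aᶜ.indicator H₂) =
      A.indicator (B.indicator H₁) + Aᶜ.indicator (B.indicator H₂) := by
    ext ω; by_cases hω : ω ∈ A <;> by_cases hωB : ω ∈ B <;> simp [hω, hωB]
  have e2 : A.indicator (B.indicator H₁) = (B ∩ A).indicator H₁ := by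
    rw [Set.indicator_indicator, Set.inter_comm]
  have e3 : Aᶜ.indicator (B.indicator H₂) = (B ∩ Aᶜ).indicator H₂ := by
    rw [Set.indicator_indicator, Set.inter_comm]
  have h3 := h.add_of_measurable (h.memLinf_indicator h₁ hB) (h.memLinf_indicator h₂ hB) hA
  rw [← e1, e2, e3] at h3
  rw [hX.setIntegral B hB, integral_congr_ae (h.ac.ae_eq h3),
    integral_add' (h.integrable (h.memLinf_indicator h₁ (hB.inter hA)))
      (h.integrable (h.memLinf_indicator h₂ (hB.inter hA.compl))),
    integral_add' (hX₁.integrable.indicator hA0).integrableOn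
      (hX₂.integrable.indicator hA0.compl).integrableOn,
    setIntegral_indicator hA0, setIntegral_indicator hA0.compl,
    hX₁.setIntegral _ (hB.inter hA), hX₂.setIntegral _ (hB.inter hA.compl)]

theorem density_convex_const [IsProbabilityMeasure Q] (h : IsRefinedBy P Q 𝓓 𝓖 𝓐 𝓕 Φ Ψ)
    (h₁ : MemLinf P 𝓓 H₁) (h₂ : MemLinf P 𝓓 H₂) {c : ℝ} (hc0 : 0 ≤ c) (hc1 : c ≤ 1)
    (hX₁ : IsLocalDensity Q 𝓖 Φ H₁ X₁) (hX₂ : IsLocalDensity Q 𝓖 Φ H₂ X₂)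
    (hX : IsLocalDensity Q 𝓖 Φ ((fun _ => c) * H₁ + (1 - fun _ => c) * H₂) X) :
    ∀ᵐ ω ∂P, X ω ≤ c * X₁ ω + (1 - c) * X₂ ω := by
  refine h.ac'.ae_le (ae_le_of_forall_setIntegral_le_sub h.le hX.stronglyMeasurable
    ((hX₁.stronglyMeasurable.const_mul c).add (hX₂.stronglyMeasurable.const_mul (1 - c)))
    hX.integrable ((hX₁.integrable.const_mul c).add (hX₂.integrable.const_mul (1 - c)))
    fun A hA => ?_)
  have m₁ := h.memLinf_indicator h₁ hA
  have m₂ := h.memLinf_indicator h₂ hA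
  have e1 : A.indicator ((fun _ => c) * H₁ + (1 - fun _ => c) * H₂) =
      (fun _ => c) * A.indicator H₁ + (1 - fun _ => c) * A.indicator H₂ := by
    ext ω; by_cases hω : ω ∈ A <;> simp [hω]
  have h3 := h.eval.convex _ _ (fun _ => c) m₁ m₂ (MemLinf.const c)
    (Eventually.of_forall fun _ => ⟨hc0, hc1⟩)
  rw [← e1] at h3
  have i := (h.integrable m₁).const_mul c
  have i' := (h.integrable m₂).const_mul (1 - c)
  have mA : MemLinf P 𝓓 (A.indicator ((fun _ => c) * H₁ + (1 - fun _ => c) * H₂)) :=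
    h.memLinf_indicator (((MemLinf.const c).mul h₁).add
      (((MemLinf.const 1).sub (MemLinf.const c)).mul h₂)) hA
  rw [hX.setIntegral A hA, integral_add (hX₁.integrable.const_mul c).integrableOn
    (hX₂.integrable.const_mul (1 - c)).integrableOn, integral_const_mul, integral_const_mul,
    hX₁.setIntegral A hA, hX₂.setIntegral A hA, ← integral_const_mul, ← integral_const_mul,
    ← integral_add i i']
  exact integral_mono_ae (h.integrable mA) (i.add i') (h.ac.ae_le h3)

/-- Replacing `H₂` by `H₁` on `A` does not change `H₂` almost surely, so the density of the pasted
payoff is `X₂`; on `A` it is also `X₁`. -/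
theorem density_eq_on [IsProbabilityMeasure Q] (h : IsRefinedBy P Q 𝓓 𝓖 𝓐 𝓕 Φ Ψ)
    (h₁ : MemLinf P 𝓓 H₁) (h₂ : MemLinf P 𝓓 H₂) (hA : MeasurableSet[𝓖] A)
    (hX₁ : IsLocalDensity Q 𝓖 Φ H₁ X₁) (hX₂ : IsLocalDensity Q 𝓖 Φ H₂ X₂)
    (heq : ∀ᵐ ω ∂P, ω ∈ A → H₁ ω = H₂ ω) : ∀ᵐ ω ∂P, ω ∈ A → X₁ ω = X₂ ω := by
  obtain ⟨X, hX⟩ := h.exists_isLocalDensity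
    ((h.memLinf_indicator h₁ hA).add (h.memLinf_indicator h₂ hA.compl))
  have h3 : A.indicator H₁ + Aᶜ.indicator H₂ =ᵐ[P] H₂ := by
    filter_upwards [heq] with ω hω
    by_cases hωA : ω ∈ A
    · simp [hωA, hω hωA]
    · simp [hωA]
  filter_upwards [h.density_paste h₁ h₂ hA hX₁ hX₂ hX, h.density_congr
    ((h.memLinf_indicator h₁ hA).add (h.memLinf_indicator h₂ hA.compl)) h₂ hX hX₂ h3] with ω a b hω
  rw [← b, a]
  simp [hω]

/-- Let `A` be the event that `Y n < X - ε` infinitely often. For each `N`, glue the `F n`, `n ≥ N`,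
along the first violation and use `H` elsewhere. The glued payoffs still tend boundedly to `H`, but
their densities are at most `X - ε 1_A`. Taking conditional expectations, Fatou for `Φ` forces `A`
to be null. -/
theorem density_fatou [IsProbabilityMeasure Q] (h : IsRefinedBy P Q 𝓓 𝓖 𝓐 𝓕 Φ Ψ)
    {F Y : ℕ → Ω → ℝ} (hF : ∀ n, MemLinf P 𝓓 (F n)) (hH : MemLinf P 𝓓 H)
    {C : ℝ} (hC : ∀ n, ∀ᵐ ω ∂P, |F n ω| ≤ C)
    (hlim : ∀ᵐ ω ∂P, Tendsto (fun n => F n ω) atTop (𝓝 (H ω)))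
    (hY : ∀ n, IsLocalDensity Q 𝓖 Φ (F n) (Y n)) (hX : IsLocalDensity Q 𝓖 Φ H X)
    {ε : ℝ} (hε : 0 < ε) : ∀ᵐ ω ∂P, ∀ᶠ n in atTop, X ω - ε ≤ Y n ω := by
  have hCH : ∀ᵐ ω ∂P, |H ω| ≤ C := by
    filter_upwards [hlim, ae_all_iff.2 hC] with ω h1 h2
    exact le_of_tendsto h1.abs (Eventually.of_forall h2)
  let E : ℕ → Set Ω := fun n => {ω | Y n ω < X ω - ε}
  have hE : ∀ n, MeasurableSet[𝓖] (E n) := fun n =>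
    (hY n).stronglyMeasurable.measurableSet_lt (hX.stronglyMeasurable.sub stronglyMeasurable_const)
  let A : Set Ω := limsup E atTop
  have hA : MeasurableSet[𝓖] A := @MeasurableSet.measurableSet_limsup _ 𝓖 _ hE
  have hmemA : ∀ ω, ω ∈ A ↔ ∃ᶠ n in atTop, ω ∈ E n := fun ω => mem_limsup_iff_frequently_mem
  -- `D N n` is the event that the first violation from index `N` on occurs at `N + n`; for every
  -- `N` these events cover `A`.
  let D : ℕ → ℕ → Set Ω := fun N => disjointed fun n => E (N + n)
  have hD : ∀ N n, MeasurableSet[𝓖] (D N n) := fun N =>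
    MeasurableSet.disjointed fun n => hE (N + n)
  choose K hK hKC hKF hKH using fun N => exists_memLinf_glue
    (fun n => h.le_domain _ (hD N n)) (disjoint_disjointed fun n => E (N + n))
    (fun n => hF (N + n)) hH (fun n => hC (N + n)) hCH
  choose Z hZ using fun N => h.exists_isLocalDensity (hK N)
  have hZle : ∀ N, ∀ᵐ ω ∂P, Z N ω ≤ X ω - A.indicator (fun _ => ε) ω := by
    intro N
    have hDu : MeasurableSet[𝓖] (⋃ n, D N n)ᶜ := (MeasurableSet.iUnion (hD N)).compl
    have e1 : ∀ᵐ ω ∂P, ∀ n, ω ∈ D N n → Z N ω = Y (N + n) ω := ae_all_iff.2 fun n =>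
      h.density_eq_on (hK N) (hF (N + n)) (hD N n) (hZ N) (hY (N + n))
        (Eventually.of_forall (hKF N n))
    have e2 := h.density_eq_on (hK N) hH hDu (hZ N) hX
      (Eventually.of_forall fun ω hω => hKH N ω (by simpa using hω))
    filter_upwards [e1, e2] with ω h1 h2
    by_cases hω : ω ∈ ⋃ n, D N n
    · obtain ⟨n, hn⟩ := Set.mem_iUnion.1 hω
      have h3 : Y (N + n) ω < X ω - ε := disjointed_subset (fun n => E (N + n)) n hn
      have h4 : A.indicator (fun _ => ε) ω ≤ ε := Set.indicator_apply_le' (fun _ => le_rfl)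
        fun _ => hε.le
      rw [h1 n hn]
      linarith
    · have hωA : ω ∉ A := fun hωA => by
        obtain ⟨n, hn, hωn⟩ := frequently_atTop.1 ((hmemA ω).1 hωA) N
        refine hω ?_
        change ω ∈ ⋃ n, disjointed (fun n => E (N + n)) n
        rw [iUnion_disjointed]
        exact Set.mem_iUnion.2 ⟨n - N, by rwa [Nat.add_sub_cancel' hn]⟩
      rw [h2 hω]
      simp [hωA]
  have hKlim : ∀ᵐ ω ∂P, Tendsto (fun N => K N ω) atTop (𝓝 (H ω)) := by
    filter_upwards [hlim] with ω hω
    rw [Metric.tendsto_atTop] at hω ⊢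
    intro δ hδ
    obtain ⟨N₀, hN₀⟩ := hω δ hδ
    refine ⟨N₀, fun N hN => ?_⟩
    by_cases hex : ∃ n, ω ∈ D N n
    · obtain ⟨n, hn⟩ := hex
      rw [hKF N n ω hn]
      exact hN₀ _ (hN.trans (Nat.le_add_right _ _))
    · rw [hKH N ω (not_exists.1 hex), dist_self]
      exact hδ
  have hAi : Integrable (A.indicator fun _ => ε) Q := (integrable_const ε).indicator (h.le _ hA)
  have hΦle : ∀ᵐ ω ∂P, ∀ N, Φ (K N) ω ≤ Φ H ω - (Q[A.indicator fun _ => ε | 𝓐]) ω := by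
    refine ae_all_iff.2 fun N => ?_
    have h1 : Q[Z N | 𝓐] ≤ᵐ[Q] Q[X - A.indicator fun _ => ε | 𝓐] :=
      condExp_mono (hZ N).integrable (hX.integrable.sub hAi) (h.ac.ae_le (hZle N))
    filter_upwards [h.condExp_range (hK N) (hZ N), h.condExp_range hH hX, h.ac'.ae_le h1,
      h.ac'.ae_eq (condExp_sub hX.integrable hAi 𝓐)] with ω a b c d
    rw [a, b]
    rw [d] at c
    exact c
  have hcond : ∀ᵐ ω ∂P, (Q[A.indicator fun _ => ε | 𝓐]) ω ≤ 0 := by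
    filter_upwards [h.eval.eventually_lt hK hH hKC hKlim, hΦle] with ω h1 h2
    refine le_of_forall_pos_le_add fun δ hδ => ?_
    obtain ⟨N, hN⟩ := (h1 δ hδ).exists
    linarith [h2 N]
  have hint : ∫ ω, A.indicator (fun _ => ε) ω ∂Q ≤ 0 := by
    rw [← integral_condExp (h.le_range.trans h.le)]
    exact integral_nonpos_of_ae (h.ac.ae_le hcond)
  rw [integral_indicator_const _ (h.le _ hA), smul_eq_mul] at hint
  have hQA : Q.real A = 0 :=
    le_antisymm (nonpos_of_mul_nonpos_left hint hε) measureReal_nonneg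
  have hPA : P A = 0 := h.ac' ((measureReal_eq_zero_iff (by finiteness)).1 hQA)
  filter_upwards [measure_eq_zero_iff_ae_notMem.1 hPA] with ω hω
  rw [hmemA, not_frequently] at hω
  filter_upwards [hω] with n hn using not_lt.1 hn

end IsRefinedBy

theorem abs_convex_comb_le {l a b A B : ℝ} (h0 : 0 ≤ l) (h1 : l ≤ 1) (ha : |a| ≤ A) (hb : |b| ≤ B) :
    |l * a + (1 - l) * b| ≤ A + B := by
  refine (abs_add_le _ _).trans (add_le_add ?_ ?_)
  · rw [abs_mul, abs_of_nonneg h0]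
    exact (mul_le_of_le_one_left (abs_nonneg _) h1).trans ha
  · rw [abs_mul, abs_of_nonneg (sub_nonneg.2 h1)]
    exact (mul_le_of_le_one_left (abs_nonneg _) (by linarith)).trans hb

theorem tendsto_floor_mul_div {x : ℝ} (hx : 0 ≤ x) :
    Tendsto (fun n : ℕ => (⌊((n : ℝ) + 1) * x⌋₊ : ℝ) / ((n : ℝ) + 1)) atTop (𝓝 x) := by
  have h1 : Tendsto (fun n : ℕ => ((n + 1 : ℕ) : ℝ)) atTop atTop :=
    tendsto_natCast_atTop_atTop.comp (tendsto_add_atTop_nat 1)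
  have h2 := (tendsto_nat_floor_mul_div_atTop hx).comp h1
  refine h2.congr fun n => ?_
  simp [mul_comm]

namespace IsRefinedBy

variable {P Q : Measure Ω} {𝓕 : Filtration ℕ m0} {Φ : (Ω → ℝ) → Ω → ℝ}
  {Ψ : ℕ → (Ω → ℝ) → Ω → ℝ} {H H₁ H₂ X X₁ X₂ : Ω → ℝ} {A : Set Ω}

/-- A 𝓖-measurable weight is not admissible for `Φ`, whose convexity concerns 𝓐-measurable weights
only. Constants are admissible, locality of the densities handles weights with countably many
values, and `density_fatou` passes to the limit. -/
theorem density_convex [IsProbabilityMeasure Q] (h : IsRefinedBy P Q 𝓓 𝓖 𝓐 𝓕 Φ Ψ)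
    (h₁ : MemLinf P 𝓓 H₁) (h₂ : MemLinf P 𝓓 H₂) {l : Ω → ℝ} (hl : MemLinf P 𝓖 l)
    (hl01 : ∀ᵐ ω ∂P, 0 ≤ l ω ∧ l ω ≤ 1)
    (hX₁ : IsLocalDensity Q 𝓖 Φ H₁ X₁) (hX₂ : IsLocalDensity Q 𝓖 Φ H₂ X₂)
    (hX : IsLocalDensity Q 𝓖 Φ (l * H₁ + (1 - l) * H₂) X) :
    X ≤ᵐ[P] l * X₁ + (1 - l) * X₂ := by
  obtain ⟨l', hl', hll'⟩ := hl.1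
  obtain ⟨C₁, hC₁⟩ := h₁.2
  obtain ⟨C₂, hC₂⟩ := h₂.2
  -- The weight is rounded down to the multiples of `1 / (n + 1)`: the result stays in `[0, 1]`
  -- almost surely and equals a constant on each event `fl n = k`.
  let fl : ℕ → Ω → ℕ := fun n ω => ⌊((n : ℝ) + 1) * l' ω⌋₊
  let q : ℕ → Ω → ℝ := fun n ω => (fl n ω : ℝ) / ((n : ℝ) + 1)
  have hfl : ∀ n, Measurable[𝓖] (fl n) := fun n =>
    Nat.measurable_floor.comp (hl'.const_mul ((n : ℝ) + 1)).measurable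
  have hqm : ∀ n, StronglyMeasurable[𝓖] (q n) := fun n =>
    Measurable.stronglyMeasurable
      ((measurable_from_top (f := fun k : ℕ => (k : ℝ) / ((n : ℝ) + 1))).comp (hfl n))
  have hn0 : ∀ n : ℕ, (0 : ℝ) < (n : ℝ) + 1 := fun n => by positivity
  have hq01 : ∀ᵐ ω ∂P, ∀ n, 0 ≤ q n ω ∧ q n ω ≤ 1 := by
    filter_upwards [hl01, hll'] with ω a b n
    rw [b] at a
    refine ⟨by positivity, (div_le_one (hn0 n)).2 ?_⟩
    exact (Nat.floor_le (mul_nonneg (hn0 n).le a.1)).trans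
      (mul_le_of_le_one_right (hn0 n).le a.2)
  have hq : ∀ n, MemLinf P 𝓖 (q n) := fun n => ⟨⟨_, hqm n, EventuallyEq.rfl⟩, 1, by
    filter_upwards [hq01] with ω hω
    rw [abs_of_nonneg (hω n).1]
    exact (hω n).2⟩
  have comb : ∀ {c : Ω → ℝ}, MemLinf P 𝓖 c → MemLinf P 𝓓 (c * H₁ + (1 - c) * H₂) := fun hc =>
    ((hc.mono h.le_domain).mul h₁).add
      (((MemLinf.const 1).sub (hc.mono h.le_domain)).mul h₂)
  choose Y hY using fun n => h.exists_isLocalDensity (comb (hq n))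
  choose Z hZ using fun c : ℝ => h.exists_isLocalDensity (comb (MemLinf.const c))
  have hYle : ∀ᵐ ω ∂P, ∀ n, Y n ω ≤ q n ω * X₁ ω + (1 - q n ω) * X₂ ω := by
    refine ae_all_iff.2 fun n => ?_
    have e1 : ∀ᵐ ω ∂P, ∀ k : ℕ, fl n ω = k → Y n ω = Z ((k : ℝ) / ((n : ℝ) + 1)) ω :=
      ae_all_iff.2 fun k => h.density_eq_on (A := {ω | fl n ω = k}) (comb (hq n))
        (comb (MemLinf.const _)) (hfl n (measurableSet_singleton k)) (hY n) (hZ _)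
        (Eventually.of_forall fun ω hω => by
          have hω' : q n ω = (k : ℝ) / ((n : ℝ) + 1) := by
            simp only [q]
            rw [show fl n ω = k from hω]
          simp [hω'])
    have e2 : ∀ᵐ ω ∂P, ∀ k : ℕ, (k : ℝ) / ((n : ℝ) + 1) ≤ 1 →
        Z ((k : ℝ) / ((n : ℝ) + 1)) ω ≤
          (k : ℝ) / ((n : ℝ) + 1) * X₁ ω + (1 - (k : ℝ) / ((n : ℝ) + 1)) * X₂ ω := by
      refine ae_all_iff.2 fun k => ?_
      by_cases hk : (k : ℝ) / ((n : ℝ) + 1) ≤ 1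
      · filter_upwards [h.density_convex_const h₁ h₂ (by positivity) hk hX₁ hX₂ (hZ _)]
          with ω hω _ using hω
      · exact Eventually.of_forall fun ω hk' => (hk hk').elim
    filter_upwards [e1, e2, hq01] with ω a b c
    rw [a _ rfl]
    exact b _ (c n).2
  have hqlim : ∀ᵐ ω ∂P, Tendsto (fun n => q n ω) atTop (𝓝 (l ω)) := by
    filter_upwards [hl01, hll'] with ω a b
    rw [b] at a ⊢
    exact tendsto_floor_mul_div a.1
  have hcomblim : ∀ᵐ ω ∂P, ∀ a b : ℝ, Tendsto (fun n => q n ω * a + (1 - q n ω) * b) atTop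
      (𝓝 (l ω * a + (1 - l ω) * b)) := by
    filter_upwards [hqlim] with ω hω a b
    exact (hω.mul_const a).add ((tendsto_const_nhds.sub hω).mul_const b)
  have hfat : ∀ᵐ ω ∂P, ∀ j : ℕ, ∀ᶠ n in atTop, X ω - 1 / ((j : ℝ) + 1) ≤ Y n ω :=
    ae_all_iff.2 fun j => h.density_fatou (C := C₁ + C₂) (fun n => comb (hq n)) (comb hl)
      (fun n => by
        filter_upwards [hq01, hC₁, hC₂] with ω a b c
        exact abs_convex_comb_le (a n).1 (a n).2 b c)
      (by filter_upwards [hcomblim] with ω hω using hω _ _) hY hX (by positivity)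
  filter_upwards [hfat, hYle, hcomblim] with ω a b c
  refine le_of_forall_pos_le_add fun ε hε => ?_
  obtain ⟨j, hj⟩ := exists_nat_one_div_lt hε
  have h1 := ge_of_tendsto (c (X₁ ω) (X₂ ω)) ((a j).mono fun n hn => hn.trans (b n))
  simp only [Pi.add_apply, Pi.mul_apply, Pi.sub_apply, Pi.one_apply]
  linarith

/-- The local densities form a `𝓖`-conditional evaluation. -/
theorem exists_isCondEvaluation [IsProbabilityMeasure Q] (h : IsRefinedBy P Q 𝓓 𝓖 𝓐 𝓕 Φ Ψ) :
    ∃ Θ : (Ω → ℝ) → Ω → ℝ, IsCondEvaluation P 𝓓 𝓖 Θ ∧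
      ∀ H, MemLinf P 𝓓 H → Φ H =ᵐ[P] Q[Θ H | 𝓐] := by
  classical
  have hex : ∀ H, ∃ X, MemLinf P 𝓓 H → IsLocalDensity Q 𝓖 Φ H X := fun H => by
    by_cases hH : MemLinf P 𝓓 H
    · exact (h.exists_isLocalDensity hH).imp fun X hX _ => hX
    · exact ⟨0, fun hH' => (hH hH').elim⟩
  choose Θ hΘ using hex
  refine ⟨Θ, ?_, fun H hH => h.condExp_range hH (hΘ H hH)⟩
  exact
    { mapsTo := fun H hH => h.memLinf_density hH (hΘ H hH)
      congr := fun H₁ H₂ h₁ h₂ heq => h.density_congr h₁ h₂ (hΘ _ h₁) (hΘ _ h₂) heq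
      normalized := h.density_zero (hΘ 0 MemLinf.zero)
      cashInvariant := fun H c hH hc =>
        h.density_add hH hc (hΘ H hH) (hΘ _ (hH.add (hc.mono h.le_domain)))
      convex := fun H₁ H₂ l h₁ h₂ hl hl01 => h.density_convex h₁ h₂ hl hl01 (hΘ _ h₁) (hΘ _ h₂)
        (hΘ _ (((hl.mono h.le_domain).mul h₁).add
          (((MemLinf.const 1).sub (hl.mono h.le_domain)).mul h₂)))
      localProperty := fun H₁ H₂ h₁ h₂ A hA => h.density_paste h₁ h₂ hA (hΘ _ h₁) (hΘ _ h₂)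
        (hΘ _ ((h.memLinf_indicator h₁ hA).add (h.memLinf_indicator h₂ hA.compl)))
      fatou := fun F H hF hH ⟨C, hC⟩ hlim => by
        have h1 : ∀ᵐ ω ∂P, ∀ j : ℕ, ∀ᶠ n in atTop, Θ H ω - 1 / ((j : ℝ) + 1) ≤ Θ (F n) ω :=
          ae_all_iff.2 fun j => h.density_fatou hF hH hC hlim (fun n => hΘ _ (hF n)) (hΘ H hH)
            (by positivity)
        filter_upwards [h1] with ω hω using le_liminf_ereal hω }

end IsRefinedBy

end MarketConsistent

namespace MarketConsistent

variable {Ω : Type*} {m0 : MeasurableSpace Ω}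

/-! ### Dynamic evaluations at stopping times -/

section Stopping

variable {P : Measure Ω} {𝓕 : Filtration ℝ≥0 m0} {T : ℝ≥0} {Φ : (Ω → ℝ≥0) → (Ω → ℝ) → Ω → ℝ}
  {σ τ : Ω → ℝ≥0} {H : Ω → ℝ} {D : Set Ω}

theorem IsStop.const {r : ℝ≥0} (hr : r ≤ T) : IsStop 𝓕 T fun _ => r :=
  ⟨isStoppingTime_const 𝓕 r, fun _ => hr⟩

theorem IsStop.sigma_const {r : ℝ≥0} (h : IsStop 𝓕 T fun _ => r) : h.sigma = 𝓕 r :=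
  IsStoppingTime.measurableSpace_const 𝓕 r

theorem IsStop.min (hσ : IsStop 𝓕 T σ) (hτ : IsStop 𝓕 T τ) :
    IsStop 𝓕 T fun ω => min (σ ω) (τ ω) :=
  ⟨hσ.1.min hτ.1, fun ω => (min_le_left _ _).trans (hσ.2 ω)⟩

theorem IsStop.sigma_le (hσ : IsStop 𝓕 T σ) : hσ.sigma ≤ 𝓕 T := fun A hA => by
  have h1 := hA.2 T
  have h2 : A ∩ {ω | ((σ ω : ℝ≥0) : WithTop ℝ≥0) ≤ T} = A :=
    Set.inter_eq_left.2 fun ω _ => WithTop.coe_le_coe.2 (hσ.2 ω)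
  rwa [h2] at h1

/-- Events known at a later stopping time are known earlier on an event where both times agree. -/
theorem IsStop.measurableSet_inter (hσ : IsStop 𝓕 T σ) (hτ : IsStop 𝓕 T τ)
    (hD : MeasurableSet[hσ.sigma] D) (heq : ∀ ω ∈ D, σ ω = τ ω) {A : Set Ω}
    (hA : MeasurableSet[hτ.sigma] A) : MeasurableSet[hσ.sigma] (D ∩ A) := by
  refine ⟨hD.1.inter hA.1, fun i => ?_⟩
  have h1 : D ∩ A ∩ {ω | ((σ ω : ℝ≥0) : WithTop ℝ≥0) ≤ i} =
      (D ∩ {ω | ((σ ω : ℝ≥0) : WithTop ℝ≥0) ≤ i}) ∩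
        (A ∩ {ω | ((τ ω : ℝ≥0) : WithTop ℝ≥0) ≤ i}) := by
    ext ω
    simp only [Set.mem_inter_iff, Set.mem_ofPred_eq]
    constructor
    · rintro ⟨⟨h1, h2⟩, h3⟩
      exact ⟨⟨h1, h3⟩, h2, heq ω h1 ▸ h3⟩
    · rintro ⟨⟨h1, h2⟩, h3, -⟩
      exact ⟨⟨h1, h3⟩, h2⟩
  rw [h1]
  exact (hD.2 i).inter (hA.2 i)

theorem IsStop.memLinf_indicator (hσ : IsStop 𝓕 T σ) (hτ : IsStop 𝓕 T τ)
    (hD : MeasurableSet[hσ.sigma] D) (heq : ∀ ω ∈ D, σ ω = τ ω) (hH : MemLinf P hτ.sigma H) :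
    MemLinf P hσ.sigma (D.indicator H) := by
  obtain ⟨⟨g, hg, hfg⟩, C, hC⟩ := hH
  refine ⟨⟨D.indicator g, Measurable.stronglyMeasurable fun B hB => ?_, ?_⟩, C, ?_⟩
  · rw [Set.indicator_preimage, Set.ite]
    exact (Set.inter_comm D _ ▸ hσ.measurableSet_inter hτ hD heq (hg.measurable hB)).union
      ((@measurable_const ℝ Ω _ hσ.sigma 0 _ hB).diff hD)
  · filter_upwards [hfg] with ω hω
    by_cases hωD : ω ∈ D <;> simp [hωD, hω]
  · filter_upwards [hC] with ω hω
    by_cases hωD : ω ∈ D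
    · simpa [hωD] using hω
    · simpa [hωD] using (abs_nonneg _).trans hω

/-- Since the times agree on `D`, the payoff `1_D Φ_τ H` is already known at `σ`, so `Φ_σ` fixes it.
Time-consistency and locality on `D` give the rest. -/
theorem IsDynamicEvaluation.eq_on_of_le (hΦ : IsDynamicEvaluation P 𝓕 T Φ) (hσ : IsStop 𝓕 T σ)
    (hτ : IsStop 𝓕 T τ) (hle : ∀ ω, σ ω ≤ τ ω) (hD : MeasurableSet[hσ.sigma] D)
    (heq : ∀ ω ∈ D, σ ω = τ ω) (hH : MemLinf P (𝓕 T) H) :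
    ∀ᵐ ω ∂P, ω ∈ D → Φ σ H ω = Φ τ H ω := by
  have hτH := (hΦ.evaluation τ hτ).mapsTo H hH
  have hD' := hσ.memLinf_indicator hτ hD heq hτH
  have h1 := (hΦ.evaluation σ hσ).ae_eq_on hσ.sigma_le (hτH.mono hτ.sigma_le)
    (hD'.mono hσ.sigma_le) hD
    (Eventually.of_forall fun ω hω => (Set.indicator_of_mem hω (Φ τ H)).symm)
  filter_upwards [hΦ.timeConsistent σ τ hσ hτ hle H hH, h1,
    (hΦ.evaluation σ hσ).apply_of_memLinf hD'] with ω a b c hω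
  rw [a, b hω, c, Set.indicator_of_mem hω]

/-- `σ` and `r` need not be ordered, so both are compared with their minimum. -/
theorem IsDynamicEvaluation.eq_on_const (hΦ : IsDynamicEvaluation P 𝓕 T Φ) (hσ : IsStop 𝓕 T σ)
    {r : ℝ≥0} (hr : r ≤ T) (hD : MeasurableSet[𝓕 r] D) (heq : ∀ ω ∈ D, σ ω = r)
    (hH : MemLinf P (𝓕 T) H) : ∀ᵐ ω ∂P, ω ∈ D → Φ σ H ω = Φ (fun _ => r) H ω := by
  have hc : IsStop 𝓕 T fun _ => r := IsStop.const hr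
  have hρ := hσ.min hc
  have hDρ : MeasurableSet[hρ.sigma] D := by
    refine ⟨le_iSup (fun r => (𝓕 r : MeasurableSpace Ω)) r _ hD, fun i => ?_⟩
    by_cases hi : r ≤ i
    · exact (𝓕.mono hi _ hD).inter (hρ.1 i)
    · convert MeasurableSet.empty
      ext ω
      simp only [Set.mem_inter_iff, Set.mem_ofPred_eq, Set.mem_empty_iff_false, iff_false, not_and]
      intro hω
      rw [heq ω hω, min_self]
      exact_mod_cast hi
  filter_upwards [hΦ.eq_on_of_le hρ hσ (fun ω => min_le_left _ _) hDρ
    (fun ω hω => by simp [heq ω hω]) hH, hΦ.eq_on_of_le hρ hc (fun ω => min_le_right _ _) hDρ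
    (fun ω hω => by simp [heq ω hω]) hH] with ω a b hω
  rw [← a hω, b hω]

/-- A dynamic evaluation is uniformly bounded over pairwise disjoint events, each evaluated at a time
at which it is known. -/
theorem IsDynamicEvaluation.exists_bound (hΦ : IsDynamicEvaluation P 𝓕 T Φ)
    (hH : MemLinf P (𝓕 T) H) {r : ℕ → ℝ≥0} (hr : ∀ j, r j ≤ T) {D : ℕ → Set Ω}
    (hD : ∀ j, MeasurableSet[𝓕 (r j)] (D j)) (hdisj : Pairwise (Function.onFun Disjoint D)) :
    ∃ C : ℝ, ∀ j, ∀ᵐ ω ∂P, ω ∈ D j → |Φ (fun _ => r j) H ω| ≤ C := by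
  classical
  -- The default value `T` makes `σ` a stopping time: for `i < T` only the events `D j` with `r j ≤
  -- i` contribute to `{σ ≤ i}`, and each of them is in `𝓕 i`.
  let σ : Ω → ℝ≥0 := fun ω => if h : ∃ j, ω ∈ D j then r h.choose else T
  have hσD : ∀ j, ∀ ω ∈ D j, σ ω = r j := fun j ω hω => by
    have h : ∃ j, ω ∈ D j := ⟨j, hω⟩
    have hj : h.choose = j := by
      by_contra hne
      exact Set.disjoint_left.1 (hdisj hne) h.choose_spec hω
    simp only [σ, dif_pos h, hj]
  have hσT : ∀ ω, σ ω ≤ T := fun ω => by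
    simp only [σ]
    split_ifs
    · exact hr _
    · exact le_rfl
  have hσ : IsStop 𝓕 T σ := by
    refine ⟨fun i => ?_, hσT⟩
    by_cases hi : T ≤ i
    · convert MeasurableSet.univ
      ext ω
      exact iff_of_true (WithTop.coe_le_coe.2 ((hσT ω).trans hi)) trivial
    · have h1 : {ω | ((σ ω : ℝ≥0) : WithTop ℝ≥0) ≤ i} = ⋃ j, ⋃ _ : r j ≤ i, D j := by
        ext ω
        simp only [Set.mem_ofPred_eq, WithTop.coe_le_coe, Set.mem_iUnion, exists_prop]
        constructor
        · intro hω
          by_cases h : ∃ j, ω ∈ D j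
          · obtain ⟨j, hj⟩ := h
            exact ⟨j, hσD j ω hj ▸ hω, hj⟩
          · simp only [σ, dif_neg h] at hω
            exact (hi hω).elim
        · rintro ⟨j, hj, hω⟩
          rwa [hσD j ω hω]
      rw [h1]
      exact MeasurableSet.iUnion fun j => MeasurableSet.iUnion fun hj => 𝓕.mono hj _ (hD j)
  obtain ⟨C, hC⟩ := ((hΦ.evaluation σ hσ).mapsTo H hH).2
  refine ⟨C, fun j => ?_⟩
  filter_upwards [hC, hΦ.eq_on_const hσ (hr j) (hD j) (hσD j) hH] with ω a b hω
  rwa [← b hω]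

end Stopping

/-! ### The grid of update times -/

section Grid

variable {k : ℕ} {t : Fin k → ℝ≥0} {T s : ℝ≥0}

theorem finite_candidates : (insert T {u | u ∈ Set.range t ∧ s < u}).Finite :=
  ((Set.finite_range t).subset fun _ hu => hu.1).insert T

theorem nextUpdate_mem : nextUpdate t T s ∈ insert T {u | u ∈ Set.range t ∧ s < u} :=
  (Set.insert_nonempty _ _).csInf_mem finite_candidates

theorem nextUpdate_le_of_mem {c : ℝ≥0} (hc : c ∈ insert T {u | u ∈ Set.range t ∧ s < u}) :
    nextUpdate t T s ≤ c := csInf_le finite_candidates.bddBelow hc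

theorem nextUpdate_le : nextUpdate t T s ≤ T := nextUpdate_le_of_mem (Set.mem_insert _ _)

theorem lt_nextUpdate (hs : s < T) : s < nextUpdate t T s := by
  rcases nextUpdate_mem (t := t) (T := T) (s := s) with h | h
  · rwa [h]
  · exact h.2

theorem nextUpdate_mem_grid : nextUpdate t T s ∈ updateGrid t T := by
  rcases nextUpdate_mem (t := t) (T := T) (s := s) with h | h
  · exact Or.inr (Or.inl h)
  · exact Or.inr (Or.inr h.1)

theorem nextUpdate_le_of_mem_grid {c : ℝ≥0} (hc : c ∈ updateGrid t T) (hsc : s < c) :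
    nextUpdate t T s ≤ c := by
  rcases hc with rfl | rfl | hc
  · exact (not_lt_zero hsc).elim
  · exact nextUpdate_le
  · exact nextUpdate_le_of_mem (Or.inr ⟨hc, hsc⟩)

/-- The largest grid point not after `s`, which exists because 0 is in the grid. No grid point
separates it from the next update, so `noInformation` applies to the pair. -/
theorem exists_lastUpdate : ∃ a ∈ updateGrid t T, a ≤ s ∧
    ∀ c ∈ updateGrid t T, ¬ (a < c ∧ c < nextUpdate t T s) := by
  have hfin : (updateGrid t T ∩ Set.Iic s).Finite :=
    (((Set.finite_range t).insert T).insert 0).inter_of_left _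
  obtain ⟨a, ha, hmax⟩ := hfin.exists_maximalFor id _ ⟨0, Or.inl rfl, zero_le (a := s)⟩
  refine ⟨a, ha.1, ha.2, fun c hc ⟨hac, hcu⟩ => ?_⟩
  rcases le_or_gt c s with h | h
  · exact (hmax ⟨hc, h⟩ hac.le).not_gt hac
  · exact (nextUpdate_le_of_mem_grid hc h).not_gt hcu

end Grid

/-! ### Information before the next update -/

section Information

variable {P : Measure Ω} {T s : ℝ≥0} {n : ℕ} {S : ℝ≥0 → Ω → Fin n → ℝ}
  {hS : ∀ t, StronglyMeasurable (S t)} {Y : ℝ≥0 → Ω → ℝ} {hY : ∀ t, StronglyMeasurable (Y t)}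
  {𝓕 : Filtration ℝ≥0 m0} {k : ℕ} {t : Fin k → ℝ≥0}

/-- The sets almost surely equal to events of `m₂` form a σ-algebra, so an inclusion up to null sets
can be checked on generators of a join. -/
theorem SigmaAELe.le_eventuallyMeasurableSpace {m₁ m₂ : MeasurableSpace Ω}
    (h : SigmaAELe P m₁ m₂) : m₁ ≤ eventuallyMeasurableSpace m₂ (ae P) := h

/-- Strictly before the next update, only the stock prices bring new information. -/
theorem UpdatesOnlyAt.filtration_aeLe (hupd : UpdatesOnlyAt P Y hY T t) (hs : s < T)
    (h𝓕 : 𝓕 = Filtration.natural S hS ⊔ Filtration.natural Y hY) {r : ℝ≥0}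
    (hr : r < nextUpdate t T s) :
    SigmaAELe P (𝓕 r) (Filtration.natural S hS (nextUpdate t T s) ⊔ 𝓕 s) := by
  obtain ⟨a, ha, has, hno⟩ := exists_lastUpdate (t := t) (T := T) (s := s)
  have hinfo := (hupd.noInformation a ha _ nextUpdate_mem_grid
    (has.trans_lt (lt_nextUpdate hs)) hno).1
  have hYs : Filtration.natural Y hY a ≤ 𝓕 s := by
    refine ((Filtration.natural Y hY).mono has).trans ?_
    rw [h𝓕]
    exact le_sup_right
  have h1 : SigmaAELe P (Filtration.natural Y hY r)
      (Filtration.natural S hS (nextUpdate t T s) ⊔ 𝓕 s) := fun A hA => by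
    have hA' : MeasurableSet[leftSigma (Filtration.natural Y hY) (nextUpdate t T s)] A :=
      le_iSup₂_of_le (f := fun r (_ : r < nextUpdate t T s) =>
        (Filtration.natural Y hY r : MeasurableSpace Ω)) r hr le_rfl A hA
    obtain ⟨B, hB, hAB⟩ := hinfo A hA'
    exact ⟨B, (hYs.trans le_sup_right) _ hB, hAB⟩
  have h2 : SigmaAELe P (Filtration.natural S hS r)
      (Filtration.natural S hS (nextUpdate t T s) ⊔ 𝓕 s) :=
    SigmaAELe.of_le (((Filtration.natural S hS).mono hr.le).trans le_sup_left)
  have h3 : 𝓕 r ≤ eventuallyMeasurableSpace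
      (Filtration.natural S hS (nextUpdate t T s) ⊔ 𝓕 s) (ae P) := by
    rw [h𝓕]
    exact sup_le (h𝓕 ▸ h2.le_eventuallyMeasurableSpace) (h𝓕 ▸ h1.le_eventuallyMeasurableSpace)
  exact h3

/-- Continuous stock prices reveal nothing at a time that was not known just before. -/
theorem natural_sup_aeLe_iSup (hScont : ∀ᵐ ω ∂P, ContinuousOn (fun t => S t ω) (Set.Icc 0 T))
    (hS𝓕 : ∀ r, Filtration.natural S hS r ≤ 𝓕 r) {u : ℝ≥0} (huT : u ≤ T) {r : ℕ → ℝ≥0}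
    (hsr : ∀ n, s ≤ r n) (hru : ∀ n, r n < u) (hlim : Tendsto r atTop (𝓝 u)) :
    SigmaAELe P (Filtration.natural S hS u ⊔ 𝓕 s) (⨆ n, 𝓕 (r n)) := by
  have hcomap : ∀ j, SigmaAELe P (MeasurableSpace.comap (S j) inferInstance) (⨆ n, 𝓕 (r n)) ∨ u < j := by
    intro j
    rcases lt_trichotomy j u with hj | rfl | hj
    · obtain ⟨N, hN⟩ := (hlim.eventually_const_lt hj).exists
      refine Or.inl (SigmaAELe.of_le ?_)
      refine le_trans ?_ (le_iSup (fun n => (𝓕 (r n) : MeasurableSpace Ω)) N)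
      exact ((Filtration.stronglyAdapted_natural hS j).measurable.comap_le.trans
        ((Filtration.natural S hS).mono hN.le)).trans (hS𝓕 (r N))
    -- Path continuity enters here: `S u` is the almost sure limit of the `S (r n)`. Coordinatewise
    -- limits give measurable versions, reassembled into one vector-valued map.
    · left
      have h1 : ∀ i : Fin n, AEStronglyMeasurable[⨆ n, 𝓕 (r n)] (fun ω => S j ω i) P := fun i => by
        refine aestronglyMeasurable_of_tendsto_sub (f := fun n ω => S (r n) ω i) (fun N => ?_) ?_
        · have h2 : Measurable[⨆ n, 𝓕 (r n)] (S (r N)) :=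
            (Filtration.stronglyAdapted_natural hS (r N)).measurable.mono ((hS𝓕 (r N)).trans
              (le_iSup (fun n => (𝓕 (r n) : MeasurableSpace Ω)) N)) le_rfl
          exact ⟨_, ((measurable_pi_apply i).comp h2).stronglyMeasurable, EventuallyEq.rfl⟩
        · filter_upwards [hScont] with ω hω
          have h3 : Tendsto (fun n => S (r n) ω) atTop (𝓝 (S j ω)) :=
            (hω j ⟨zero_le, huT⟩).tendsto.comp (tendsto_nhdsWithin_iff.2
              ⟨hlim, Eventually.of_forall fun n => ⟨zero_le, (hru n).le.trans huT⟩⟩)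
          exact (tendsto_pi_nhds.1 h3) i
      choose g hg hSg using h1
      rintro A ⟨C, hC, rfl⟩
      refine ⟨(fun ω i => g i ω) ⁻¹' C, (@measurable_pi_iff _ _ _ (⨆ n, 𝓕 (r n)) _ _).2
        (fun i => (hg i).measurable) hC, ?_⟩
      have h4 : ∀ᵐ ω ∂P, S j ω = fun i => g i ω := by
        filter_upwards [ae_all_iff.2 hSg] with ω hω
        exact funext hω
      filter_upwards [h4] with ω hω
      change (S j ω ∈ C) = ((fun i => g i ω) ∈ C)
      rw [hω]
    · exact Or.inr hj
  have h5 : Filtration.natural S hS u ⊔ 𝓕 s ≤ eventuallyMeasurableSpace (⨆ n, 𝓕 (r n)) (ae P) := by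
    refine sup_le (iSup₂_le fun j hj => ?_) ?_
    · exact ((hcomap j).resolve_right hj.not_gt).le_eventuallyMeasurableSpace
    · exact (SigmaAELe.of_le ((𝓕.mono (hsr 0)).trans
        (le_iSup (fun n => (𝓕 (r n) : MeasurableSpace Ω)) 0))).le_eventuallyMeasurableSpace
  exact h5

end Information

theorem IsMartingaleDensity.absolutelyContinuous {P : Measure Ω} {T : ℝ≥0} {n : ℕ}
    {S : ℝ≥0 → Ω → Fin n → ℝ} {hS : ∀ t, StronglyMeasurable (S t)} {Z : Ω → ℝ}
    (hZ : IsMartingaleDensity P S hS T Z) (hpos : ∀ᵐ ω ∂P, 0 < Z ω) : P ≪ densityMeasure P Z := by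
  have hZm : AEStronglyMeasurable Z P := hZ.measurable.mono ((Filtration.natural S hS).le T)
  refine withDensity_absolutelyContinuous' hZm.aemeasurable.ennreal_ofReal ?_
  filter_upwards [hpos] with ω hω
  exact (ENNReal.ofReal_pos.2 hω).ne'

end MarketConsistent

/-! ### Assembling the theorem -/

theorem mainTheorem6 {Ω : Type*} {m0 : MeasurableSpace Ω} (P : Measure Ω) [IsProbabilityMeasure P]
    (T : ℝ≥0) (hT : 0 < T)
    -- the stock prices (continuous) and the insurance process
    {n : ℕ} (S : ℝ≥0 → Ω → Fin n → ℝ) (hS : ∀ t, StronglyMeasurable (S t))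
    (hScont : ∀ᵐ ω ∂P, ContinuousOn (fun t => S t ω) (Set.Icc 0 T))
    (Y : ℝ≥0 → Ω → ℝ) (hY : ∀ t, StronglyMeasurable (Y t))
    {k : ℕ} (t : Fin k → ℝ≥0) (htmono : Monotone t) (htT : ∀ i, t i ≤ T)
    (hYupd : MarketConsistent.UpdatesOnlyAt P Y hY T t)
    -- the pricing measure of the complete financial market
    (Z : Ω → ℝ) (hZ : MarketConsistent.IsCompleteMarketDensity P S hS T Z)
    (Q : Measure Ω) (hQ : Q = MarketConsistent.densityMeasure P Z)
    -- the total information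
    (𝓕 : Filtration ℝ≥0 m0) (h𝓕 : 𝓕 = Filtration.natural S hS ⊔ Filtration.natural Y hY)
    -- the evaluation
    (Φ : (Ω → ℝ≥0) → (Ω → ℝ) → Ω → ℝ)
    (hΦ : MarketConsistent.IsDynamicEvaluation P 𝓕 T Φ)
    (hmc : MarketConsistent.IsMarketConsistent P Q (Filtration.natural S hS T) 𝓕 T Φ)
    (hcase :
      (∀ σ, MarketConsistent.IsStop 𝓕 T σ → MarketConsistent.IsMonotone P (𝓕 T) (Φ σ)) ∨
      (∀ σ (hσ : MarketConsistent.IsStop 𝓕 T σ),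
        MarketConsistent.IsPNormBounded P (𝓕 T) hσ.sigma (Φ σ)) ∨
      (∀ σ (hσ : MarketConsistent.IsStop 𝓕 T σ),
        MarketConsistent.IsPosHomogeneous P (𝓕 T) hσ.sigma (Φ σ)))
    (s : ℝ≥0) (hs : s ≤ T) :
    ∃ Ψ : (Ω → ℝ) → Ω → ℝ,
      MarketConsistent.IsCondEvaluation P (𝓕 (MarketConsistent.nextUpdate t T s))
        (Filtration.natural S hS (MarketConsistent.nextUpdate t T s) ⊔ 𝓕 s) Ψ ∧
      ∀ H, MarketConsistent.MemLinf P (𝓕 (MarketConsistent.nextUpdate t T s)) H →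
        Φ (fun _ => s) H =ᵐ[P] Q[Ψ H | 𝓕 s] := by
  have hac : Q ≪ P := hQ ▸ withDensity_absolutelyContinuous _ _
  have hac' : P ≪ Q := hQ ▸ hZ.isMartingaleDensity.absolutelyContinuous hZ.pos
  have hprob : IsProbabilityMeasure Q := hQ ▸ hZ.isMartingaleDensity.isProb
  have hS𝓕 : ∀ r, Filtration.natural S hS r ≤ 𝓕 r := fun r => by
    rw [h𝓕]
    exact le_sup_left
  have heval : ∀ r ≤ T, MarketConsistent.IsCondEvaluation P (𝓕 T) (𝓕 r) (Φ fun _ => r) :=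
    fun r hr => by
      have h1 := hΦ.evaluation _ (MarketConsistent.IsStop.const (𝓕 := 𝓕) hr)
      rwa [MarketConsistent.IsStop.sigma_const] at h1
  have hmcs : ∀ HS H, MarketConsistent.MemLinf P (Filtration.natural S hS T ⊔ 𝓕 s) HS →
      MarketConsistent.MemLinf P (𝓕 T) H →
      Φ (fun _ => s) (HS + H) =ᵐ[P] Q[HS | 𝓕 s] + Φ (fun _ => s) H := fun HS H h1 h2 => by
    have hc : MarketConsistent.IsStop 𝓕 T fun _ => s := MarketConsistent.IsStop.const hs
    have h3 := hmc _ hc HS H (by rwa [hc.sigma_const]) h2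
    rwa [hc.sigma_const] at h3
  rcases hs.eq_or_lt with rfl | hsT
  -- At `s = T` the next update time is `T` itself and both σ-algebras are `𝓕 s`; the evaluation at
  -- `s` serves, being fixed by the conditional expectation.
  · have hu : MarketConsistent.nextUpdate t s s = s :=
      le_antisymm MarketConsistent.nextUpdate_le <| by
        rcases MarketConsistent.nextUpdate_mem (t := t) (T := s) (s := s) with h | h
        · exact h.ge
        · exact h.2.le
    rw [hu, sup_eq_right.2 (hS𝓕 s)]
    refine ⟨Φ fun _ => s, heval s le_rfl, fun H hH => ?_⟩
    have h1 := (heval s le_rfl).mapsTo H hH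
    obtain ⟨g, hg, hfg⟩ := h1.1
    exact (hac'.ae_eq (condExp_of_aestronglyMeasurable' (𝓕.le s) ⟨g, hg, hac.ae_eq hfg⟩
      (h1.integrable (𝓕.le s) hac))).symm
  · set u := MarketConsistent.nextUpdate t T s with hu
    have huT : u ≤ T := MarketConsistent.nextUpdate_le
    -- The times approach `u` strictly from below, since new insurance information may arrive at `u`
    -- itself.
    obtain ⟨r, hrmono, hr, hrlim⟩ :=
      exists_seq_strictMono_tendsto' (MarketConsistent.lt_nextUpdate (t := t) hsT)
    have hrT : ∀ n, r n ≤ T := fun n => (hr n).2.le.trans huT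
    let 𝓕r : Filtration ℕ m0 :=
      { seq := fun n => 𝓕 (r n)
        mono' := fun i j hij => 𝓕.mono (hrmono.monotone hij)
        le' := fun n => 𝓕.le (r n) }
    have hdom : Filtration.natural S hS u ⊔ 𝓕 s ≤ 𝓕 T :=
      sup_le ((hS𝓕 u).trans (𝓕.mono huT)) (𝓕.mono hs)
    have hsub : Filtration.natural S hS u ⊔ 𝓕 s ≤ Filtration.natural S hS T ⊔ 𝓕 s :=
      sup_le_sup_right ((Filtration.natural S hS).mono huT) _
    have hinfo : ∀ n, MarketConsistent.SigmaAELe P (𝓕 (r n)) (Filtration.natural S hS u ⊔ 𝓕 s) :=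
      fun n => hYupd.filtration_aeLe hsT h𝓕 (hr n).2
    have href : MarketConsistent.IsRefinedBy P Q (𝓕 T) (Filtration.natural S hS u ⊔ 𝓕 s) (𝓕 s)
        𝓕r (Φ fun _ => s) (fun n => Φ fun _ => r n) :=
      { ac := hac
        ac' := hac'
        le_base := 𝓕.le T
        le_domain := hdom
        le_range := le_sup_right
        le_filtration := fun n => 𝓕.mono (hr n).1.le
        filtration_le := fun n => 𝓕.mono (hrT n)
        eval := heval s hs
        eval_refined := fun n => heval (r n) (hrT n)
        -- `Φ_{r n} H` is measurable for 𝓖 up to null sets, so after time-consistency it is priced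
        -- by `Q` as a hedgeable payoff added to 0.
        condExp_refined := fun n H hH => by
          have h1 := hΦ.timeConsistent _ _ (MarketConsistent.IsStop.const hs)
            (MarketConsistent.IsStop.const (hrT n)) (fun _ => (hr n).1.le) H hH
          have h2 := hmcs _ 0 ((hinfo n).memLinf ((heval _ (hrT n)).mapsTo H hH) |>.mono hsub)
            MarketConsistent.MemLinf.zero
          rw [add_zero] at h2
          filter_upwards [h1, h2, (heval s hs).normalized] with ω a b c
          rw [a, b, Pi.add_apply, c]
          simp
        market := fun h H hh hH => hmcs h H (hh.mono hsub) hH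
        aeLe_iSup := MarketConsistent.natural_sup_aeLe_iSup hScont hS𝓕 huT
          (fun n => (hr n).1.le) (fun n => (hr n).2) hrlim
        filtration_aeLe := hinfo
        bounded := fun H hH i D hD hdisj =>
          hΦ.exists_bound hH (fun j => hrT (i j)) hD hdisj }
    obtain ⟨Θ, hΘ, hΦΘ⟩ := href.exists_isCondEvaluation
    -- The construction was carried out on all of `L^∞(𝓕 T)`, where the given evaluations act; the
    -- result is restricted to payoffs known at `u`.
    exact ⟨Θ, hΘ.mono_left (𝓕.mono huT), fun H hH => hΦΘ H (hH.mono (𝓕.mono huT))⟩
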